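/- **Theorem (strong completeness of $\mathsf{QBK}^\sharp$).** Let $\sigma$ be an (at most) countable signature consisting of predicate symbols with arities and constant symbols, without function symbols. Then for every set $\Gamma$ of $\sigma$-sentences and every set $\Delta$ of $\sigma$-formulas, $$\Gamma\vdash_\sharp\Delta\iff\Gamma\vDash_\sharp\Delta .$$ *Language.* Formulas are built from atomic formulas $P(t_1,\dots,t_n)$ (without equality; each $t_i$ is a variable from a fixed countably infinite set or a constant of $\sigma$) and $\bot$ by $\to,\wedge,\vee,\sim,\square,\lozenge,\forall x,\exists x$. Sentences are formulas without free variables. Put $\neg\Phi:=\Phi\to\bot$, $\Phi\leftrightarrow\Psi:=(\Phi\to\Psi)\wedge(\Psi\to\Phi)$, $\Phi\Leftrightarrow\Psi:=(\Phi\leftrightarrow\Psi)\wedge({\sim}\Phi\leftrightarrow{\sim}\Psi)$. *Calculus.* $\mathsf{QBK}^\sharp$ is the least set of $\sigma$-formulas that contains all instances of - $\Phi\to(\Psi\to\Phi)$; $(\Phi\to(\Psi\to\Theta))\to((\Phi\to\Psi)\to(\Phi\to\Theta))$; $\Phi\wedge\Psi\to\Phi$; $\Phi\wedge\Psi\to\Psi$;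 $\Phi\to(\Psi\to\Phi\wedge\Psi)$; $\Phi\to\Phi\vee\Psi$; $\Psi\to\Phi\vee\Psi$; $(\Phi\to\Theta)\to((\Psi\to\Theta)\to(\Phi\vee\Psi\to\Theta))$; $\Phi\vee(\Phi\to\bot)$; $\bot\to\Phi$; - ${\sim}{\sim}\Phi\leftrightarrow\Phi$; ${\sim}(\Phi\to\Psi)\leftrightarrow(\Phi\wedge{\sim}\Psi)$; ${\sim}(\Phi\vee\Psi)\leftrightarrow({\sim}\Phi\wedge{\sim}\Psi)$; ${\sim}(\Phi\wedge\Psi)\leftrightarrow({\sim}\Phi\vee{\sim}\Psi)$; ${\sim}\bot$; - $(\square\Phi\wedge\square\Psi)\to\square(\Phi\wedge\Psi)$; $\square(\Phi\to\Phi)$; - $\neg\square\Phi\leftrightarrow\lozenge\neg\Phi$; $\neg\lozenge\Phi\leftrightarrow\square\neg\Phi$; $\square\Phi\Leftrightarrow{\sim}\lozenge{\sim}\Phi$; $\lozenge\Phi\Leftrightarrow{\sim}\square{\sim}\Phi$; - $\forall x\,\Phi\to\Phi(x/t)$ and $\Phi(x/t)\to\exists x\,\Phi$, where $t$ is free for $x$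 in $\Phi$; ${\sim}\forall x\,\Phi\leftrightarrow\exists x\,{\sim}\Phi$; ${\sim}\exists x\,\Phi\leftrightarrow\forall x\,{\sim}\Phi$; - the Barcan scheme $\lozenge\exists x\,\Phi\to\exists x\,\lozenge\Phi$ and is closed under modus ponens; from $\Phi\to\Psi$ infer $\square\Phi\to\square\Psi$; from $\Phi\to\Psi$ infer $\lozenge\Phi\to\lozenge\Psi$; and the Bernays rules: from $\Phi\to\Psi$ infer $\Phi\to\forall x\,\Psi$ if $x$ is not free in $\Phi$, and infer $\exists x\,\Phi\to\Psi$ if $x$ is not free in $\Psi$. $\Gamma\vdash_\sharp\Delta$ means that some finite disjunction $\Phi_1\vee\dots\vee\Phi_n$ of members of $\Delta$ (the empty disjunction being $\bot$) can be obtained from $\Gamma\cup\mathsf{QBK}^\sharp$ by modus ponens and the Bernays rules. *Semantics.* A $\mathsf{QBK}^\sharp$-model consists of a nonempty set $W$ of worlds, an arbitrary relation $R\subseteq W\times W$, and for each $w\in W$ two $\sigma$-structures $\mathfrak A_w^+,\mathfrak A_w^-$ with the same nonempty carrier $A_w$ and the same interpretation of the constants, such that $A_u=A_v$ for all $u,v\in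 W$, and $uRv$ implies that each constant has the same interpretation at $u$ and $v$. Verification $\Vdash^+$ and falsification $\Vdash^-$ of sentences with parameters from $A_w$ are defined inductively, where $\underline a$ is a name for $a$: - for atomic $\Theta$: $w\Vdash^\pm\Theta$ iff $\mathfrak A_w^\pm\models\Theta$; $w\nVdash^+\bot$; $w\Vdash^-\bot$; - $w\Vdash^+\Phi\wedge\Psi$ iff $w\Vdash^+\Phi$ and $w\Vdash^+\Psi$; $w\Vdash^-\Phi\wedge\Psi$ iff $w\Vdash^-\Phi$ or $w\Vdash^-\Psi$; - $w\Vdash^+\Phi\vee\Psi$ iff $w\Vdash^+\Phi$ or $w\Vdash^+\Psi$; $w\Vdash^-\Phi\vee\Psi$ iff $w\Vdash^-\Phi$ and $w\Vdash^-\Psi$; - $w\Vdash^+\Phi\to\Psi$ iff $w\nVdash^+\Phi$ or $w\Vdash^+\Psi$; $w\Vdash^-\Phi\to\Psi$ iff $w\Vdash^+\Phi$ and $w\Vdash^-\Psi$; - $w\Vdash^+{\sim}\Phi$ iff $w\Vdash^-\Phi$; $w\Vdash^-{\sim}\Phi$ iff $w\Vdash^+\Phi$; - $w\Vdash^+\square\Phi$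 iff $u\Vdash^+\Phi$ for all $u$ with $wRu$; $w\Vdash^-\square\Phi$ iff $u\Vdash^-\Phi$ for some $u$ with $wRu$; - $w\Vdash^+\lozenge\Phi$ iff $u\Vdash^+\Phi$ for some $u$ with $wRu$; $w\Vdash^-\lozenge\Phi$ iff $u\Vdash^-\Phi$ for all $u$ with $wRu$; - $w\Vdash^+\forall x\,\Phi$ iff $w\Vdash^+\Phi(x/\underline a)$ for all $a\in A_w$; $w\Vdash^-\forall x\,\Phi$ iff $w\Vdash^-\Phi(x/\underline a)$ for some $a\in A_w$; - $w\Vdash^+\exists x\,\Phi$ iff $w\Vdash^+\Phi(x/\underline a)$ for some $a\in A_w$; $w\Vdash^-\exists x\,\Phi$ iff $w\Vdash^-\Phi(x/\underline a)$ for all $a\in A_w$. $\Gamma\vDash_\sharp\Delta$ means: for every $\mathsf{QBK}^\sharp$-model, every world $w$ and every substitution $\lambda$ of (names of) elements of $A_w$ for the variables, if $w\Vdash^+\Phi$ for all $\Phi\in\Gamma$, then $w\Vdash^+\lambda\Psi$ for some $\Psi\in\Delta$. -/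

import Mathlib

universe u v w

namespace QBK

/-! ## Syntax -/

/-- A first-order signature without function symbols: predicate symbols with arities, and
constant symbols. -/
structure Signature where
  Pred : Type u
  arity : Pred → ℕ
  Const : Type u

/-- The fixed countable set of individual variables. -/
abbrev Var : Type := ℕ

inductive Term (σ : Signature.{u}) : Type u
  | var (x : Var) : Term σ
  | const (c : σ.Const) : Term σ

/-- Formulas; `snot` is the strong negation `∼`. -/
inductive Formula (σ : Signature.{u}) : Type u
  | bot : Formula σ
  | atom (P : σ.Pred) (t : Fin (σ.arity P) → Term σ) : Formula σ
  | imp (φ ψ : Formula σ) : Formula σ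
  | and (φ ψ : Formula σ) : Formula σ
  | or (φ ψ : Formula σ) : Formula σ
  | snot (φ : Formula σ) : Formula σ
  | box (φ : Formula σ) : Formula σ
  | dia (φ : Formula σ) : Formula σ
  | all (x : Var) (φ : Formula σ) : Formula σ
  | ex (x : Var) (φ : Formula σ) : Formula σ

namespace Formula

variable {σ : Signature.{u}}

/-- `¬Φ := Φ → ⊥`. -/
def neg (φ : Formula σ) : Formula σ := imp φ bot

/-- `Φ ↔ Ψ := (Φ → Ψ) ∧ (Ψ → Φ)`. -/
def iff (φ ψ : Formula σ) : Formula σ := and (imp φ ψ) (imp ψ φ)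

/-- `Φ ⇔ Ψ := (Φ ↔ Ψ) ∧ (∼Φ ↔ ∼Ψ)`. -/
def siff (φ ψ : Formula σ) : Formula σ := and (iff φ ψ) (iff (snot φ) (snot ψ))

/-- `FreeIn x Φ`: the variable `x` occurs free in `Φ`. -/
def FreeIn (x : Var) : Formula σ → Prop
  | bot => False
  | atom _ t => ∃ i, t i = Term.var x
  | imp φ ψ => FreeIn x φ ∨ FreeIn x ψ
  | and φ ψ => FreeIn x φ ∨ FreeIn x ψ
  | or φ ψ => FreeIn x φ ∨ FreeIn x ψ
  | snot φ => FreeIn x φ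
  | box φ => FreeIn x φ
  | dia φ => FreeIn x φ
  | all y φ => x ≠ y ∧ FreeIn x φ
  | ex y φ => x ≠ y ∧ FreeIn x φ

/-- A sentence is a formula without free variables. -/
def IsSentence (φ : Formula σ) : Prop := ∀ x, ¬ FreeIn x φ

end Formula

/-- The result of applying a substitution to a term. -/
def Term.subst {σ : Signature.{u}} (s : Var → Term σ) : Term σ → Term σ
  | .var x => s x
  | .const c => .const c

namespace Formula

variable {σ : Signature.{u}}

/-- Simultaneous substitution of the terms `s x` for all free occurrences of the variables `x`
(bound variables are not renamed). -/
def subst (s : Var → Term σ) : Formula σ → Formula σ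
  | bot => bot
  | atom P t => atom P (fun i => (t i).subst s)
  | imp φ ψ => imp (subst s φ) (subst s ψ)
  | and φ ψ => and (subst s φ) (subst s ψ)
  | or φ ψ => or (subst s φ) (subst s ψ)
  | snot φ => snot (subst s φ)
  | box φ => box (subst s φ)
  | dia φ => dia (subst s φ)
  | all x φ => all x (subst (Function.update s x (Term.var x)) φ)
  | ex x φ => ex x (subst (Function.update s x (Term.var x)) φ)

/-- `Φ(x/t)`. -/
def inst (x : Var) (t : Term σ) (φ : Formula σ) : Formula σ :=
  subst (Function.update Term.var x t) φ

/-- The term `t` is free for `x` in `Φ`: no free occurrence of `x` in `Φ` lies in the scope of a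
quantifier binding a variable of `t`. -/
def FreeFor (x : Var) (t : Term σ) : Formula σ → Prop
  | bot => True
  | atom _ _ => True
  | imp φ ψ => FreeFor x t φ ∧ FreeFor x t ψ
  | and φ ψ => FreeFor x t φ ∧ FreeFor x t ψ
  | or φ ψ => FreeFor x t φ ∧ FreeFor x t ψ
  | snot φ => FreeFor x t φ
  | box φ => FreeFor x t φ
  | dia φ => FreeFor x t φ
  | all y φ => FreeIn x (all y φ) → t ≠ Term.var y ∧ FreeFor x t φ
  | ex y φ => FreeIn x (ex y φ) → t ≠ Term.var y ∧ FreeFor x t φ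

/-- The disjunction `Φ₁ ∨ ⋯ ∨ Φₙ`; the empty disjunction is `⊥`. -/
def listOr : List (Formula σ) → Formula σ
  | [] => bot
  | [φ] => φ
  | φ :: ψ :: l => or φ (listOr (ψ :: l))

end Formula

/-- `Disj Γ`: all finite disjunctions of members of `Γ`. -/
def Disj {σ : Signature.{u}} (Γ : Set (Formula σ)) : Set (Formula σ) :=
  {χ | ∃ l : List (Formula σ), (∀ φ ∈ l, φ ∈ Γ) ∧ χ = Formula.listOr l}

/-! ## The Hilbert calculus -/

section Calculus

open Formula

variable {σ : Signature.{u}}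

/-- The axiom schemes of `QBK`. -/
inductive BaseAx : Formula σ → Prop
  | i1 (φ ψ : Formula σ) : BaseAx (imp φ (imp ψ φ))
  | i2 (φ ψ θ : Formula σ) :
      BaseAx (imp (imp φ (imp ψ θ)) (imp (imp φ ψ) (imp φ θ)))
  | c1 (φ ψ : Formula σ) : BaseAx (imp (and φ ψ) φ)
  | c2 (φ ψ : Formula σ) : BaseAx (imp (and φ ψ) ψ)
  | c3 (φ ψ : Formula σ) : BaseAx (imp φ (imp ψ (and φ ψ)))
  | d1 (φ ψ : Formula σ) : BaseAx (imp φ (or φ ψ))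
  | d2 (φ ψ : Formula σ) : BaseAx (imp ψ (or φ ψ))
  | d3 (φ ψ θ : Formula σ) :
      BaseAx (imp (imp φ θ) (imp (imp ψ θ) (imp (or φ ψ) θ)))
  | n1 (φ : Formula σ) : BaseAx (or φ (imp φ bot))
  | n2 (φ : Formula σ) : BaseAx (imp bot φ)
  | sn1 (φ : Formula σ) : BaseAx (iff (snot (snot φ)) φ)
  | sn2 (φ ψ : Formula σ) : BaseAx (iff (snot (imp φ ψ)) (and φ (snot ψ)))
  | sn3 (φ ψ : Formula σ) : BaseAx (iff (snot (or φ ψ)) (and (snot φ) (snot ψ)))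
  | sn4 (φ ψ : Formula σ) : BaseAx (iff (snot (and φ ψ)) (or (snot φ) (snot ψ)))
  | sn5 : BaseAx (snot bot)
  | k1 (φ ψ : Formula σ) : BaseAx (imp (and (box φ) (box ψ)) (box (and φ ψ)))
  | k2 (φ : Formula σ) : BaseAx (box (imp φ φ))
  | m1 (φ : Formula σ) : BaseAx (iff (neg (box φ)) (dia (neg φ)))
  | m2 (φ : Formula σ) : BaseAx (iff (neg (dia φ)) (box (neg φ)))
  | m3 (φ : Formula σ) : BaseAx (siff (box φ) (snot (dia (snot φ))))
  | m4 (φ : Formula σ) : BaseAx (siff (dia φ) (snot (box (snot φ))))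
  | q1 (x : Var) (t : Term σ) (φ : Formula σ) (h : FreeFor x t φ) :
      BaseAx (imp (all x φ) (inst x t φ))
  | q2 (x : Var) (t : Term σ) (φ : Formula σ) (h : FreeFor x t φ) :
      BaseAx (imp (inst x t φ) (ex x φ))
  | q3 (x : Var) (φ : Formula σ) : BaseAx (iff (snot (all x φ)) (ex x (snot φ)))
  | q4 (x : Var) (φ : Formula σ) : BaseAx (iff (snot (ex x φ)) (all x (snot φ)))

/-- `QBK♯`: the least set of formulas that contains the axiom schemes of `QBK` and the Barcan
scheme and is closed under modus ponens, monotonicity for `□` and `◇`, and the Bernays rules. -/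
inductive Sharp : Formula σ → Prop
  | base {φ : Formula σ} (h : BaseAx φ) : Sharp φ
  | ba (x : Var) (φ : Formula σ) : Sharp (imp (dia (ex x φ)) (ex x (dia φ)))
  | mp {φ ψ : Formula σ} (h₁ : Sharp φ) (h₂ : Sharp (imp φ ψ)) : Sharp ψ
  | mb {φ ψ : Formula σ} (h : Sharp (imp φ ψ)) : Sharp (imp (box φ) (box ψ))
  | md {φ ψ : Formula σ} (h : Sharp (imp φ ψ)) : Sharp (imp (dia φ) (dia ψ))
  | br1 {x : Var} {φ ψ : Formula σ} (hx : ¬ FreeIn x φ) (h : Sharp (imp φ ψ)) :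
      Sharp (imp φ (all x ψ))
  | br2 {x : Var} {φ ψ : Formula σ} (hx : ¬ FreeIn x ψ) (h : Sharp (imp φ ψ)) :
      Sharp (imp (ex x φ) ψ)

/-- Formulas obtainable from `Γ ∪ QBK♯` by modus ponens and the Bernays rules. -/
inductive Derivable (Γ : Set (Formula σ)) : Formula σ → Prop
  | hyp {φ : Formula σ} (h : φ ∈ Γ) : Derivable Γ φ
  | logic {φ : Formula σ} (h : Sharp φ) : Derivable Γ φ
  | mp {φ ψ : Formula σ} (h₁ : Derivable Γ φ) (h₂ : Derivable Γ (imp φ ψ)) : Derivable Γ ψ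
  | br1 {x : Var} {φ ψ : Formula σ} (hx : ¬ FreeIn x φ) (h : Derivable Γ (imp φ ψ)) :
      Derivable Γ (imp φ (all x ψ))
  | br2 {x : Var} {φ ψ : Formula σ} (hx : ¬ FreeIn x ψ) (h : Derivable Γ (imp φ ψ)) :
      Derivable Γ (imp (ex x φ) ψ)

/-- `Γ ⊢♯ Δ`: some finite disjunction of members of `Δ` is derivable from `Γ`. -/
def SharpProves (Γ Δ : Set (Formula σ)) : Prop := ∃ χ ∈ Disj Δ, Derivable Γ χ

end Calculus

/-! ## Semantics -/

/-- A `σ`-structure whose carrier is a nonempty subset of the ambient type `U`. -/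
structure Struct (σ : Signature.{u}) (U : Type w) where
  carrier : Set U
  carrier_nonempty : carrier.Nonempty
  const : σ.Const → U
  const_mem : ∀ c, const c ∈ carrier
  rel : (P : σ.Pred) → Set (Fin (σ.arity P) → U)
  rel_subset : ∀ P, ∀ a ∈ rel P, ∀ i, a i ∈ carrier

/-- `QBK`-models (with expanding carriers); `U` is any type containing all the carriers. -/
structure Model (σ : Signature.{u}) where
  World : Type v
  world_nonempty : Nonempty World
  R : World → World → Prop
  U : Type w
  pos : World → Struct σ U
  neg : World → Struct σ U
  carrier_eq : ∀ i, (neg i).carrier = (pos i).carrier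
  const_eq : ∀ i c, (neg i).const c = (pos i).const c
  carrier_mono : ∀ i j, R i j → (pos i).carrier ⊆ (pos j).carrier
  const_rigid : ∀ i j, R i j → ∀ c, (pos i).const c = (pos j).const c

namespace Model

variable {σ : Signature.{u}}

/-- The carrier `A_i` of the world `i`. -/
def dom (M : Model.{u, v, w} σ) (i : M.World) : Set M.U := (M.pos i).carrier

/-- `QBK♯`-models: `QBK`-models in which all worlds have the same carrier. -/
def IsSharp (M : Model.{u, v, w} σ) : Prop := ∀ i j, M.dom i = M.dom j

end Model

/-- The value of a term in a structure when each variable `x` stands for (the name of) `s x`. -/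
def Term.value {σ : Signature.{u}} {U : Type w} (A : Struct σ U) (s : Var → U) : Term σ → U
  | .var x => s x
  | .const c => A.const c

namespace Model

variable {σ : Signature.{u}}

mutual

/-- `M.Verifies φ i s`: the result of replacing every free variable `x` of `φ` by the name of
the element `s x` is verified at the world `i`. -/
def Verifies (M : Model.{u, v, w} σ) : Formula σ → M.World → (Var → M.U) → Prop
  | .bot, _, _ => False
  | .atom P t, i, s => (fun k => (t k).value (M.pos i) s) ∈ (M.pos i).rel P
  | .imp φ ψ, i, s => ¬ M.Verifies φ i s ∨ M.Verifies ψ i s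
  | .and φ ψ, i, s => M.Verifies φ i s ∧ M.Verifies ψ i s
  | .or φ ψ, i, s => M.Verifies φ i s ∨ M.Verifies ψ i s
  | .snot φ, i, s => M.Falsifies φ i s
  | .box φ, i, s => ∀ j, M.R i j → M.Verifies φ j s
  | .dia φ, i, s => ∃ j, M.R i j ∧ M.Verifies φ j s
  | .all x φ, i, s => ∀ a ∈ M.dom i, M.Verifies φ i (Function.update s x a)
  | .ex x φ, i, s => ∃ a ∈ M.dom i, M.Verifies φ i (Function.update s x a)

/-- `M.Falsifies φ i s`: the result of replacing every free variable `x` of `φ` by the name of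
the element `s x` is falsified at the world `i`. -/
def Falsifies (M : Model.{u, v, w} σ) : Formula σ → M.World → (Var → M.U) → Prop
  | .bot, _, _ => True
  | .atom P t, i, s => (fun k => (t k).value (M.neg i) s) ∈ (M.neg i).rel P
  | .imp φ ψ, i, s => M.Verifies φ i s ∧ M.Falsifies ψ i s
  | .and φ ψ, i, s => M.Falsifies φ i s ∨ M.Falsifies ψ i s
  | .or φ ψ, i, s => M.Falsifies φ i s ∧ M.Falsifies ψ i s
  | .snot φ, i, s => M.Verifies φ i s
  | .box φ, i, s => ∃ j, M.R i j ∧ M.Falsifies φ j s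
  | .dia φ, i, s => ∀ j, M.R i j → M.Falsifies φ j s
  | .all x φ, i, s => ∃ a ∈ M.dom i, M.Falsifies φ i (Function.update s x a)
  | .ex x φ, i, s => ∀ a ∈ M.dom i, M.Falsifies φ i (Function.update s x a)

end

end Model

/-- `Γ ⊨♯ Δ`, for a set `Γ` of sentences and a set `Δ` of formulas: for every `QBK♯`-model, every
world `i` and every `s : Var → A_i`, if all members of `Γ` are verified at `i`, then so is the
`s`-instance of some member of `Δ`. (The members of `Γ` are closed, so `s` is irrelevant
for them.) -/
def SharpEntails {σ : Signature.{u}} (Γ Δ : Set (Formula σ)) : Prop :=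
  ∀ M : Model.{u, v, w} σ, M.IsSharp →
    ∀ (i : M.World) (s : Var → M.U), (∀ x, s x ∈ M.dom i) →
      (∀ φ ∈ Γ, M.Verifies φ i s) → ∃ ψ ∈ Δ, M.Verifies ψ i s

end QBK

-- Completeness is a Henkin argument adapted to constant domains. Since all worlds share one
-- carrier, the theory of a successor world cannot receive new constants as witnesses. The invariant
-- used instead of fresh constants is `OmegaComplete`. It survives the addition of a sentence
-- (`OmegaComplete.insert_sentence`), and in a countable language it suffices for a maximal
-- extension with witnesses (`OmegaComplete.exists_isHenkin`). By the Barcan scheme it passes from a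
-- Henkin set `w` to `{ψ | box ψ ∈ w}` (`IsHenkin.omegaComplete_box`). Hence successors exist over
-- the same constants (`IsHenkin.box_mem`). The truth lemma `canonicalModel_truth` treats
-- verification and falsification together: falsifying Φ means containing ∼Φ, and the axioms for ∼
-- drive it inward.
--
-- For the initial world, variables are read as new constants, with infinitely many further
-- constants kept spare. Every theory named in this way is ω-complete (`omegaComplete_name`): a
-- spare constant in a derivation can be replaced by a fresh variable, which is then generalized.
-- The opposite translation turns an inconsistency into a derivation in the original language
-- (`sharpProves_of_name`).
--
-- The construction uses `Prov`, where modus ponens is the only rule applied to hypotheses, so the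
-- deduction theorem and Lindenbaum's lemma hold without conditions on variables. Bernays rules on
-- derived formulas are needed only to rename variables back (`Derivable.of_shift`).
--
-- Soundness is an induction on derivations. Constant carriers validate the Barcan scheme, and rigid
-- constants allow substitution under modal operators.

namespace QBK

open Formula

section Logic

variable {σ : Signature.{u}} {S T : Set (Formula σ)} {φ ψ : Formula σ}

/-! ## Local derivability -/

/-- Formulas obtainable from `T ∪ QBK♯` by modus ponens alone. -/
inductive Prov (T : Set (Formula σ)) : Formula σ → Prop
  | hyp {φ : Formula σ} (h : φ ∈ T) : Prov T φ
  | logic {φ : Formula σ} (h : Sharp φ) : Prov T φ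
  | mp {φ ψ : Formula σ} (h₁ : Prov T φ) (h₂ : Prov T (imp φ ψ)) : Prov T ψ

namespace Prov

theorem base (h : BaseAx φ) : Prov T φ := logic (.base h)

theorem mono (hST : S ⊆ T) (h : Prov S φ) : Prov T φ := by
  induction h with
  | hyp h => exact hyp (hST h)
  | logic h => exact logic h
  | mp _ _ ih₁ ih₂ => exact mp ih₁ ih₂

theorem imp_self : Prov T (imp φ φ) :=
  mp (base (.i1 φ φ)) (mp (base (.i1 φ (imp φ φ))) (base (.i2 _ _ _)))

theorem weaken (h : Prov T ψ) : Prov T (imp φ ψ) := mp h (base (.i1 _ _))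

/-- The deduction theorem. -/
theorem ded (h : Prov (insert φ T) ψ) : Prov T (imp φ ψ) := by
  induction h with
  | hyp h =>
    rcases h with rfl | h
    · exact imp_self
    · exact weaken (hyp h)
  | logic h => exact weaken (logic h)
  | mp _ _ ih₁ ih₂ => exact mp ih₁ (mp ih₂ (base (.i2 _ _ _)))

theorem sharp (h : Prov (∅ : Set (Formula σ)) φ) : Sharp φ := by
  induction h with
  | hyp h => exact h.elim
  | logic h => exact h
  | mp _ _ ih₁ ih₂ => exact .mp ih₁ ih₂

theorem derivable (h : Prov T φ) : Derivable T φ := by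
  induction h with
  | hyp h => exact .hyp h
  | logic h => exact .logic h
  | mp _ _ ih₁ ih₂ => exact .mp ih₁ ih₂

theorem exists_of_sUnion {c : Set (Set (Formula σ))} (hne : c.Nonempty)
    (hc : DirectedOn (· ⊆ ·) c) (h : Prov (⋃₀ c) φ) : ∃ S ∈ c, Prov S φ := by
  induction h with
  | hyp h =>
    obtain ⟨S, hS, hφ⟩ := h
    exact ⟨S, hS, hyp hφ⟩
  | logic h =>
    obtain ⟨S, hS⟩ := hne
    exact ⟨S, hS, logic h⟩
  | mp _ _ ih₁ ih₂ =>
    obtain ⟨S₁, hS₁, h₁⟩ := ih₁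
    obtain ⟨S₂, hS₂, h₂⟩ := ih₂
    obtain ⟨S, hS, hS₁S, hS₂S⟩ := hc S₁ hS₁ S₂ hS₂
    exact ⟨S, hS, mp (h₁.mono hS₁S) (h₂.mono hS₂S)⟩

end Prov

/-! ## Maximal consistent sets -/

/-- Maximal consistent sets of formulas. -/
structure IsMax (T : Set (Formula σ)) : Prop where
  con : ¬ Prov T bot
  max : ∀ φ, φ ∈ T ∨ neg φ ∈ T

namespace IsMax

theorem mem_of_prov (h : IsMax T) (hφ : Prov T φ) : φ ∈ T :=
  (h.max φ).resolve_right fun hn => h.con (.mp hφ (.hyp hn))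

theorem mem_of_sharp (h : IsMax T) (hφ : Sharp φ) : φ ∈ T := h.mem_of_prov (.logic hφ)

theorem mem_of_sharp_imp (h : IsMax T) (hi : Sharp (imp φ ψ)) (hφ : φ ∈ T) : ψ ∈ T :=
  h.mem_of_prov (.mp (.hyp hφ) (.logic hi))

theorem bot_mem (h : IsMax T) : bot ∈ T ↔ False := ⟨fun hb => h.con (.hyp hb), False.elim⟩

theorem imp_mem (h : IsMax T) : imp φ ψ ∈ T ↔ (φ ∈ T → ψ ∈ T) := by
  refine ⟨fun hi hφ => h.mem_of_prov (.mp (.hyp hφ) (.hyp hi)), fun hi => ?_⟩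
  rcases h.max φ with hφ | hφ
  · exact h.mem_of_prov (.weaken (.hyp (hi hφ)))
  · exact h.mem_of_prov (.ded (.mp (.mp (.hyp (Set.mem_insert _ _))
      (.hyp (Set.mem_insert_of_mem _ hφ))) (.base (.n2 _))))

theorem neg_mem (h : IsMax T) : neg φ ∈ T ↔ φ ∉ T := by
  rw [neg, h.imp_mem, h.bot_mem]

theorem and_mem (h : IsMax T) : and φ ψ ∈ T ↔ φ ∈ T ∧ ψ ∈ T :=
  ⟨fun hi => ⟨h.mem_of_sharp_imp (.base (.c1 _ _)) hi, h.mem_of_sharp_imp (.base (.c2 _ _)) hi⟩,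
    fun hi => h.mem_of_prov (.mp (.hyp hi.2) (.mp (.hyp hi.1) (.base (.c3 _ _))))⟩

theorem or_mem (h : IsMax T) : or φ ψ ∈ T ↔ φ ∈ T ∨ ψ ∈ T := by
  refine ⟨fun hi => ?_, ?_⟩
  · by_contra! hc
    have h₁ : imp φ bot ∈ T := h.neg_mem.2 hc.1
    have h₂ : imp ψ bot ∈ T := h.neg_mem.2 hc.2
    exact h.con (.mp (.hyp hi) (.mp (.hyp h₂) (.mp (.hyp h₁) (.base (.d3 _ _ _)))))
  · rintro (hi | hi)
    · exact h.mem_of_sharp_imp (.base (.d1 _ _)) hi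
    · exact h.mem_of_sharp_imp (.base (.d2 _ _)) hi

theorem iff_mem (h : IsMax T) : Formula.iff φ ψ ∈ T ↔ (φ ∈ T ↔ ψ ∈ T) := by
  rw [Formula.iff, h.and_mem, h.imp_mem, h.imp_mem]
  exact iff_iff_implies_and_implies.symm

theorem mem_iff (h : IsMax T) (hi : BaseAx (Formula.iff φ ψ)) : φ ∈ T ↔ ψ ∈ T :=
  h.iff_mem.1 (h.mem_of_sharp (.base hi))

theorem listOr_mem (h : IsMax T) {l : List (Formula σ)} : listOr l ∈ T ↔ ∃ φ ∈ l, φ ∈ T := by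
  induction l with
  | nil => simp [listOr, h.bot_mem]
  | cons a l ih =>
    cases l with
    | nil => simp [listOr]
    | cons b l => rw [listOr, h.or_mem, ih]; simp

end IsMax

/-- Lindenbaum's lemma. -/
theorem exists_isMax (hT : ¬ Prov T bot) : ∃ u, T ⊆ u ∧ IsMax u := by
  obtain ⟨u, hTu, hu⟩ := zorn_subset_nonempty {S : Set (Formula σ) | ¬ Prov S bot}
    (fun c hc hch hne => ⟨⋃₀ c, fun hp => by
      obtain ⟨S, hS, hb⟩ := Prov.exists_of_sUnion hne hch.directedOn hp
      exact hc hS hb, fun s hs => Set.subset_sUnion_of_mem hs⟩) T hT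
  refine ⟨u, hTu, hu.prop, fun φ => ?_⟩
  by_contra! hc
  have key : ∀ ψ, ψ ∉ u → Prov u (neg ψ) := fun ψ hψ => by
    by_contra hn
    exact hψ (hu.le_of_ge (y := insert ψ u) (fun hb => hn (.ded hb)) (Set.subset_insert _ _)
      (Set.mem_insert _ _))
  exact hu.prop (.mp (key φ hc.1) (key _ hc.2))

/-- This replaces propositional Hilbert derivations by Boolean reasoning about membership in maximal
sets, which `tauto` can finish. -/
theorem prov_iff : Prov T φ ↔ ∀ u, IsMax u → T ⊆ u → φ ∈ u := by
  refine ⟨fun h u hu hT => hu.mem_of_prov (h.mono hT), fun h => ?_⟩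
  by_contra hn
  have hcon : ¬ Prov (insert (neg φ) T) bot := fun hb => by
    exact hn (.mp (.base (.n1 φ)) (.mp (.mp hb.ded (.mp (.weaken (.base (.n2 φ)))
      (.base (.i2 _ _ _)))) (.mp .imp_self (.base (.d3 _ _ _)))))
  obtain ⟨u, hTu, hu⟩ := exists_isMax hcon
  exact hu.neg_mem.1 (hTu (Set.mem_insert _ _)) (h u hu ((Set.subset_insert _ _).trans hTu))

theorem sharp_iff : Sharp φ ↔ ∀ u, IsMax u → φ ∈ u :=
  ⟨fun h _ hu => hu.mem_of_sharp h, fun h => (prov_iff.2 fun u hu _ => h u hu).sharp⟩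

/-- If `T` together with the negations of members of `D` derives `φ`, then `T` derives the
disjunction of `φ` and finitely many members of `D`. -/
theorem Prov.exists_listOr {D : Set (Formula σ)} (h : Prov (T ∪ neg '' D) φ) :
    ∃ l : List (Formula σ), (∀ δ ∈ l, δ ∈ D) ∧ Prov T (or φ (listOr l)) := by
  induction h with
  | hyp h =>
    rcases h with h | ⟨δ, hδ, rfl⟩
    · exact ⟨[], by simp, prov_iff.2 fun u hu hT => hu.or_mem.2 (.inl (hT h))⟩
    · exact ⟨[δ], by simpa using hδ, prov_iff.2 fun u hu hT => hu.or_mem.2 (hu.max δ).symm⟩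
  | logic h => exact ⟨[], by simp, prov_iff.2 fun u hu hT => hu.or_mem.2 (.inl (hu.mem_of_sharp h))⟩
  | mp _ _ ih₁ ih₂ =>
    obtain ⟨l₁, hl₁, h₁⟩ := ih₁
    obtain ⟨l₂, hl₂, h₂⟩ := ih₂
    refine ⟨l₁ ++ l₂, by simpa [or_imp, forall_and] using ⟨hl₁, hl₂⟩, prov_iff.2 fun u hu hT => ?_⟩
    have h₁ := prov_iff.1 h₁ u hu hT
    have h₂ := prov_iff.1 h₂ u hu hT
    rw [hu.or_mem, hu.listOr_mem] at h₁ h₂ ⊢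
    rw [hu.imp_mem] at h₂
    simp only [List.mem_append]
    grind

/-! ## Variables and quantifiers -/

theorem freeFor_const (x : Var) (c : σ.Const) (φ : Formula σ) : FreeFor x (.const c) φ := by
  induction φ <;> simp_all [FreeFor]

theorem freeFor_self (x : Var) (φ : Formula σ) : FreeFor x (.var x) φ := by
  induction φ <;> simp_all [FreeFor, FreeIn]

theorem subst_var (φ : Formula σ) : subst Term.var φ = φ := by
  induction φ with
  | atom p t =>
    simp only [subst, Formula.atom.injEq, heq_eq_eq, true_and]
    funext i
    cases t i <;> rfl
  | _ => simp_all [subst]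

theorem inst_self (x : Var) (φ : Formula σ) : inst x (.var x) φ = φ := by
  rw [inst, Function.update_eq_self, subst_var]

theorem sharp_all_imp (x : Var) (φ : Formula σ) : Sharp (imp (all x φ) φ) := by
  simpa only [inst_self] using Sharp.base (.q1 x (.var x) φ (freeFor_self x φ))

theorem Derivable.gen (x : Var) (h : Derivable T φ) : Derivable T (all x φ) :=
  .mp (.logic (.base (.n2 bot))) (.br1 (x := x) (by simp [FreeIn])
    (.mp h (.logic (.base (.i1 φ (imp bot bot))))))

theorem Sharp.gen (x : Var) (h : Sharp φ) : Sharp (all x φ) :=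
  .mp (.base (.n2 bot)) (.br1 (x := x) (by simp [FreeIn])
    (.mp h (.base (.i1 φ (imp bot bot)))))

theorem Derivable.inst {x : Var} {t : Term σ} (hf : FreeFor x t φ) (h : Derivable T φ) :
    Derivable T (inst x t φ) :=
  .mp (h.gen x) (.logic (.base (.q1 x t φ hf)))

theorem sharp_all_imp_dist {x : Var} (hx : ¬ FreeIn x φ) :
    Sharp (imp (all x (imp φ ψ)) (imp φ (all x ψ))) := by
  have h : Sharp (imp (and (all x (imp φ ψ)) φ) (all x ψ)) := by
    refine .br1 (by simp [FreeIn, hx]) (sharp_iff.2 fun u hu => ?_)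
    have := hu.mem_of_sharp (sharp_all_imp x (imp φ ψ))
    simp only [hu.imp_mem, hu.and_mem] at this ⊢
    tauto
  refine sharp_iff.2 fun u hu => ?_
  have := hu.mem_of_sharp h
  simp only [hu.imp_mem, hu.and_mem] at this ⊢
  tauto

theorem sharp_all_mono {x : Var} (h : Sharp (imp φ ψ)) : Sharp (imp (all x φ) (all x ψ)) := by
  refine .br1 (by simp [FreeIn]) (sharp_iff.2 fun u hu => ?_)
  have h₁ := hu.mem_of_sharp h
  have h₂ := hu.mem_of_sharp (sharp_all_imp x φ)
  simp only [hu.imp_mem] at h₁ h₂ ⊢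
  tauto

theorem sharp_all_imp_all (x : Var) (φ ψ : Formula σ) :
    Sharp (imp (all x (imp φ ψ)) (imp (all x φ) (all x ψ))) := by
  have h₁ : Sharp (imp (all x (imp φ ψ)) (all x (imp (all x φ) ψ))) := by
    refine sharp_all_mono (sharp_iff.2 fun u hu => ?_)
    have h₂ := hu.mem_of_sharp (sharp_all_imp x φ)
    simp only [hu.imp_mem] at h₂ ⊢
    tauto
  refine sharp_iff.2 fun u hu => ?_
  have h₁ := hu.mem_of_sharp h₁
  have h₂ := hu.mem_of_sharp (sharp_all_imp_dist (x := x) (φ := all x φ) (ψ := ψ) (by simp [FreeIn]))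
  simp only [hu.imp_mem] at h₁ h₂ ⊢
  tauto

/-- Modus ponens commutes with ∀ by distributivity, and hypotheses without `x` free generalize
vacuously; so generalization is admissible although `Prov` has no quantifier rule. -/
theorem Prov.gen {x : Var} (hT : ∀ ψ ∈ T, ¬ FreeIn x ψ) (h : Prov T φ) : Prov T (all x φ) := by
  induction h with
  | hyp h => exact .mp (.hyp h) (.logic (.br1 (hT _ h) (Prov.sharp .imp_self)))
  | logic h => exact .logic (h.gen x)
  | mp _ _ ih₁ ih₂ => exact .mp ih₁ (.mp ih₂ (.logic (sharp_all_imp_all x _ _)))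

/-! ## Necessity -/

/-- Necessitation comes from □(Φ → Φ) and monotonicity applied to (Φ → Φ) → Φ. -/
theorem Sharp.nec (h : Sharp φ) : Sharp (box φ) :=
  .mp (.base (.k2 φ)) (.mb (.mp h (.base (.i1 φ (imp φ φ)))))

/-- The Barcan formula for `□`. -/
theorem sharp_barcan_box (x : Var) (φ : Formula σ) :
    Sharp (imp (all x (box φ)) (box (all x φ))) := by
  have h₁ : Sharp (imp (neg (all x φ)) (ex x (neg φ))) := by
    have : Sharp (imp (neg (ex x (neg φ))) (all x φ)) := by
      refine .br1 (by simp [FreeIn, neg]) (sharp_iff.2 fun u hu => ?_)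
      have := hu.mem_of_sharp (.base (.q2 x (.var x) (neg φ) (freeFor_self x _)))
      rw [inst_self] at this
      simp only [hu.imp_mem, hu.neg_mem] at this ⊢
      tauto
    refine sharp_iff.2 fun u hu => ?_
    have := hu.mem_of_sharp this
    simp only [hu.imp_mem, hu.neg_mem] at this ⊢
    tauto
  have h₂ : Sharp (imp (ex x (dia (neg φ))) (neg (all x (box φ)))) := by
    refine .br2 (by simp [FreeIn, neg]) (sharp_iff.2 fun u hu => ?_)
    have h₃ := hu.mem_of_sharp (sharp_all_imp x (box φ))
    have h₄ := hu.mem_iff (.m1 φ)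
    simp only [hu.imp_mem, hu.neg_mem] at h₃ h₄ ⊢
    tauto
  -- Contraposition along the chain ¬□∀xΦ, ◇¬∀xΦ, ◇∃x¬Φ, ∃x◇¬Φ, ¬∀x□Φ; the third step is the Barcan
  -- axiom.
  refine sharp_iff.2 fun u hu => ?_
  have h₁ := hu.mem_of_sharp h₁.md
  have h₂ := hu.mem_of_sharp h₂
  have h₃ := hu.mem_of_sharp (.ba x (neg φ))
  have h₄ := hu.mem_iff (.m1 (all x φ))
  simp only [hu.imp_mem, hu.neg_mem] at h₁ h₂ h₃ h₄ ⊢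
  tauto

/-- Closure under modus ponens is the K principle, obtained from monotonicity for Φ ∧ (Φ → Ψ) → Ψ
and the distribution of □ over ∧. -/
theorem IsMax.box_mem_of_prov (h : IsMax T) (hφ : Prov {ψ | box ψ ∈ T} φ) : box φ ∈ T := by
  induction hφ with
  | hyp h => exact h
  | logic hs => exact h.mem_of_sharp hs.nec
  | mp _ _ ih₁ ih₂ =>
    rename_i φ ψ _ _
    have h₁ : Sharp (imp (and φ (imp φ ψ)) ψ) := sharp_iff.2 fun u hu => by
      simp only [hu.imp_mem, hu.and_mem]; tauto
    exact h.mem_of_sharp_imp h₁.mb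
      (h.mem_of_sharp_imp (.base (.k1 _ _)) (h.and_mem.2 ⟨ih₁, ih₂⟩))

end Logic

section Gsub

/-! ## Simultaneous substitution for constants and variables -/

variable {P : Type u} {ar : P → ℕ} {C C' C'' : Type u}

/-- Replace the constants according to `f` and the variables according to `s`. -/
def Term.gsub (f : C → Term ⟨P, ar, C'⟩) (s : Var → Term ⟨P, ar, C'⟩) :
    Term ⟨P, ar, C⟩ → Term ⟨P, ar, C'⟩
  | .var x => s x
  | .const c => f c

namespace Formula

/-- Replace the constants according to `f` and the free variables according to `s`. -/
def gsub (f : C → Term ⟨P, ar, C'⟩) (s : Var → Term ⟨P, ar, C'⟩) :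
    Formula ⟨P, ar, C⟩ → Formula ⟨P, ar, C'⟩
  | bot => bot
  | atom p t => atom p (fun i => (t i).gsub f s)
  | imp φ ψ => imp (gsub f s φ) (gsub f s ψ)
  | and φ ψ => and (gsub f s φ) (gsub f s ψ)
  | or φ ψ => or (gsub f s φ) (gsub f s ψ)
  | snot φ => snot (gsub f s φ)
  | box φ => box (gsub f s φ)
  | dia φ => dia (gsub f s φ)
  | all x φ => all x (gsub f (Function.update s x (Term.var x)) φ)
  | ex x φ => ex x (gsub f (Function.update s x (Term.var x)) φ)

/-- A strict upper bound for all variables that occur in a formula. -/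
def varBound {σ : Signature.{u}} : Formula σ → ℕ
  | bot => 0
  | atom _ t => Finset.univ.sup fun i => match t i with
      | .var x => x + 1
      | .const _ => 0
  | imp φ ψ => max (varBound φ) (varBound ψ)
  | and φ ψ => max (varBound φ) (varBound ψ)
  | or φ ψ => max (varBound φ) (varBound ψ)
  | snot φ => varBound φ
  | box φ => varBound φ
  | dia φ => varBound φ
  | all x φ => max (x + 1) (varBound φ)
  | ex x φ => max (x + 1) (varBound φ)

/-- The set of constants that occur in a formula. -/
def consts {σ : Signature.{u}} : Formula σ → Set σ.Const
  | bot => ∅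
  | atom _ t => {c | ∃ i, t i = Term.const c}
  | imp φ ψ => consts φ ∪ consts ψ
  | and φ ψ => consts φ ∪ consts ψ
  | or φ ψ => consts φ ∪ consts ψ
  | snot φ => consts φ
  | box φ => consts φ
  | dia φ => consts φ
  | all _ φ => consts φ
  | ex _ φ => consts φ

end Formula

theorem Formula.FreeIn.lt_varBound {σ : Signature.{u}} {x : Var} {φ : Formula σ} (h : FreeIn x φ) :
    x < φ.varBound := by
  induction φ with
  | bot => exact h.elim
  | atom p t =>
    obtain ⟨i, hi⟩ := h
    refine Nat.lt_of_succ_le (le_trans ?_ (Finset.le_sup (Finset.mem_univ i)))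
    simp [hi]
  | _ => simp_all [FreeIn, varBound] <;> tauto

theorem finite_consts {σ : Signature.{u}} (φ : Formula σ) : φ.consts.Finite := by
  induction φ with
  | atom p t =>
    refine Set.Finite.of_finite_image (f := Term.const) ((Set.finite_range t).subset ?_)
      fun c _ d _ h => by injection h
    rintro _ ⟨c, ⟨i, hi⟩, rfl⟩
    exact ⟨i, hi⟩
  | _ => simp_all [consts]

theorem gsub_congr {f g : C → Term ⟨P, ar, C'⟩} {s t : Var → Term ⟨P, ar, C'⟩}
    {φ : Formula ⟨P, ar, C⟩} (hf : ∀ c ∈ φ.consts, f c = g c)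
    (hs : ∀ x, FreeIn x φ → s x = t x) : gsub f s φ = gsub g t φ := by
  have upd : ∀ {s t : Var → Term ⟨P, ar, C'⟩} {φ : Formula ⟨P, ar, C⟩} (x : Var),
      (∀ y, y ≠ x ∧ FreeIn y φ → s y = t y) → ∀ y, FreeIn y φ →
      Function.update s x (Term.var x) y = Function.update t x (Term.var x) y := by
    intro s t φ x h y hy
    by_cases hyx : y = x
    · subst hyx; simp
    · simpa [hyx] using h y ⟨hyx, hy⟩
  induction φ generalizing s t with
  | atom p r =>
    simp only [gsub, Formula.atom.injEq, heq_eq_eq, true_and]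
    funext i
    cases hi : r i with
    | var x => exact hs x ⟨i, hi⟩
    | const c => exact hf c ⟨i, hi⟩
  | all x φ ih => exact congrArg _ (ih hf (upd x hs))
  | ex x φ ih => exact congrArg _ (ih hf (upd x hs))
  | bot => rfl
  | imp φ ψ ih₁ ih₂ =>
    exact congrArg₂ _ (ih₁ (fun c h => hf c (.inl h)) fun x h => hs x (.inl h))
      (ih₂ (fun c h => hf c (.inr h)) fun x h => hs x (.inr h))
  | and φ ψ ih₁ ih₂ =>
    exact congrArg₂ _ (ih₁ (fun c h => hf c (.inl h)) fun x h => hs x (.inl h))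
      (ih₂ (fun c h => hf c (.inr h)) fun x h => hs x (.inr h))
  | or φ ψ ih₁ ih₂ =>
    exact congrArg₂ _ (ih₁ (fun c h => hf c (.inl h)) fun x h => hs x (.inl h))
      (ih₂ (fun c h => hf c (.inr h)) fun x h => hs x (.inr h))
  | snot φ ih => exact congrArg _ (ih hf hs)
  | box φ ih => exact congrArg _ (ih hf hs)
  | dia φ ih => exact congrArg _ (ih hf hs)

theorem subst_eq_gsub (s : Var → Term ⟨P, ar, C⟩) (φ : Formula ⟨P, ar, C⟩) :
    subst s φ = gsub Term.const s φ := by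
  induction φ generalizing s with
  | atom p t =>
    simp only [subst, gsub, Formula.atom.injEq, heq_eq_eq, true_and]
    funext i
    cases t i <;> rfl
  | _ => simp_all [subst, gsub]

theorem gsub_const_var (φ : Formula ⟨P, ar, C⟩) : gsub Term.const Term.var φ = φ := by
  rw [← subst_eq_gsub, subst_var]

/-- Composition of substitutions, if the first one does not introduce variables that get bound. -/
theorem gsub_gsub {N : ℕ} {f : C → Term ⟨P, ar, C'⟩} {s : Var → Term ⟨P, ar, C'⟩}
    {g : C' → Term ⟨P, ar, C''⟩} {t : Var → Term ⟨P, ar, C''⟩} {φ : Formula ⟨P, ar, C⟩}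
    (hφ : φ.varBound ≤ N) (hf : ∀ c y, f c = .var y → N ≤ y)
    (hs : ∀ x y, s x = .var y → y = x ∨ N ≤ y) :
    gsub g t (gsub f s φ) = gsub (fun c => (f c).gsub g t) (fun x => (s x).gsub g t) φ := by
  -- Under a binder `x < N`, a variable brought in by the first substitution is at least `N` or
  -- comes from itself. It therefore differs from `x`, and resetting `t` at `x` does not affect it.
  have key : ∀ (x : Var) (φ : Formula ⟨P, ar, C⟩) (s : Var → Term ⟨P, ar, C'⟩)
      (t : Var → Term ⟨P, ar, C''⟩), x < N → (∀ x y, s x = .var y → y = x ∨ N ≤ y) →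
      gsub (fun c => (f c).gsub g (Function.update t x (.var x)))
        (fun y => (Function.update s x (.var x) y).gsub g (Function.update t x (.var x))) φ =
      gsub (fun c => (f c).gsub g t) (Function.update (fun y => (s y).gsub g t) x (.var x)) φ := by
    intro x φ s t hx hs
    refine gsub_congr (fun c _ => ?_) fun y _ => ?_
    · cases hc : f c with
      | const d => rfl
      | var z =>
        have := hf c z hc
        simp [Term.gsub, Function.update_of_ne (show z ≠ x by dsimp only [Var] at *; omega)]
    · by_cases hyx : y = x
      · subst hyx; simp [Term.gsub]
      · simp only [Function.update_of_ne hyx]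
        cases hy : s y with
        | const d => rfl
        | var z =>
          have := hs y z hy
          simp [Term.gsub, Function.update_of_ne (show z ≠ x by dsimp only [Var] at *; omega)]
  have upd : ∀ (x : Var) (s : Var → Term ⟨P, ar, C'⟩), (∀ x y, s x = .var y → y = x ∨ N ≤ y) →
      ∀ z y, Function.update s x (.var x) z = .var y → y = z ∨ N ≤ y := by
    intro x s hs z y h
    by_cases hzx : z = x
    · subst hzx; simp at h; exact .inl h.symm
    · rw [Function.update_of_ne hzx] at h; exact hs z y h
  induction φ generalizing s t with
  | atom p r =>
    simp only [gsub, Formula.atom.injEq, heq_eq_eq, true_and]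
    funext i
    cases r i <;> rfl
  | all x φ ih =>
    simp only [varBound, max_le_iff] at hφ
    exact congrArg _ ((ih hφ.2 (upd x s hs)).trans (key x φ s t hφ.1 hs))
  | ex x φ ih =>
    simp only [varBound, max_le_iff] at hφ
    exact congrArg _ ((ih hφ.2 (upd x s hs)).trans (key x φ s t hφ.1 hs))
  | bot => rfl
  | imp φ ψ ih₁ ih₂ | and φ ψ ih₁ ih₂ | or φ ψ ih₁ ih₂ =>
    simp only [varBound, max_le_iff] at hφ
    exact congrArg₂ _ (ih₁ hφ.1 hs) (ih₂ hφ.2 hs)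
  | snot φ ih | box φ ih | dia φ ih => exact congrArg _ (ih hφ hs)

/-- Composition of substitutions, if the second one only replaces constants. -/
theorem gsub_var_gsub (f : C → Term ⟨P, ar, C'⟩) (s : Var → Term ⟨P, ar, C'⟩)
    (g : C' → Term ⟨P, ar, C''⟩) (φ : Formula ⟨P, ar, C⟩) :
    gsub g .var (gsub f s φ) =
      gsub (fun c => (f c).gsub g .var) (fun x => (s x).gsub g .var) φ := by
  have upd : ∀ (s : Var → Term ⟨P, ar, C'⟩) (x : Var),
      (fun y => (Function.update s x (.var x) y).gsub g .var) =
        Function.update (fun y => (s y).gsub g .var) x (.var x) := fun s x => by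
    funext y
    by_cases hyx : y = x
    · subst hyx; simp [Term.gsub]
    · simp [Function.update_of_ne hyx]
  induction φ generalizing s with
  | atom p r =>
    simp only [gsub, Formula.atom.injEq, heq_eq_eq, true_and]
    funext i
    cases r i <;> rfl
  | all x φ ih | ex x φ ih =>
    simp only [gsub, Function.update_eq_self]
    rw [ih, upd]
  | _ => simp_all [gsub]

theorem Formula.FreeIn.of_gsub {f : C → Term ⟨P, ar, C'⟩} {s : Var → Term ⟨P, ar, C'⟩}
    {φ : Formula ⟨P, ar, C⟩} {z : Var} (h : FreeIn z (gsub f s φ)) :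
    (∃ x, FreeIn x φ ∧ s x = .var z) ∨ ∃ c, f c = .var z := by
  have key : ∀ (x : Var) (φ : Formula ⟨P, ar, C⟩) (s : Var → Term ⟨P, ar, C'⟩), z ≠ x →
      ((∃ y, FreeIn y φ ∧ Function.update s x (.var x) y = .var z) ∨ ∃ c, f c = .var z) →
      (∃ y, (y ≠ x ∧ FreeIn y φ) ∧ s y = .var z) ∨ ∃ c, f c = .var z := by
    rintro x φ s hzx (⟨y, hy, h⟩ | h)
    · by_cases hyx : y = x
      · subst hyx
        simp only [Function.update_self, Term.var.injEq] at h
        exact (hzx h.symm).elim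
      · rw [Function.update_of_ne hyx] at h
        exact .inl ⟨y, ⟨hyx, hy⟩, h⟩
    · exact .inr h
  induction φ generalizing s with
  | bot => exact h.elim
  | atom p r =>
    obtain ⟨i, hi⟩ := h
    dsimp only at hi
    cases hr : r i with
    | var x => rw [hr] at hi; exact .inl ⟨x, ⟨i, hr⟩, hi⟩
    | const c => rw [hr] at hi; exact .inr ⟨c, hi⟩
  | all x φ ih | ex x φ ih => exact key x φ s h.1 (ih h.2)
  | snot φ ih | box φ ih | dia φ ih => exact ih h
  | imp φ ψ ih₁ ih₂ | and φ ψ ih₁ ih₂ | or φ ψ ih₁ ih₂ =>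
    rcases h with h | h
    · exact (ih₁ h).imp_left fun ⟨x, hx, e⟩ => ⟨x, .inl hx, e⟩
    · exact (ih₂ h).imp_left fun ⟨x, hx, e⟩ => ⟨x, .inr hx, e⟩

/-- If the substitution `s` introduces the fresh variable `z` only for `k`, then `k` is free for
`z` in the result. -/
theorem freeFor_gsub {s : Var → Term ⟨P, ar, C⟩} {φ : Formula ⟨P, ar, C⟩} {z k : Var}
    (hφ : φ.varBound ≤ z) (hs : ∀ x, s x = .var z → x = k) :
    FreeFor z (.var k) (gsub Term.const s φ) := by
  have upd : ∀ (s : Var → Term ⟨P, ar, C⟩) (x : Var), x < z → (∀ x, s x = .var z → x = k) →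
      ∀ y, Function.update s x (.var x) y = .var z → y = k ∧ y ≠ x := by
    intro s x hx hs y h
    by_cases hyx : y = x
    · subst hyx
      simp only [Function.update_self, Term.var.injEq] at h
      (dsimp only [Var] at *; omega)
    · rw [Function.update_of_ne hyx] at h
      exact ⟨hs y h, hyx⟩
  induction φ generalizing s with
  | bot | atom p r => trivial
  | all x φ ih | ex x φ ih =>
    simp only [varBound, max_le_iff] at hφ
    intro hz
    refine ⟨?_, ih hφ.2 fun y hy => (upd s x hφ.1 hs y hy).1⟩
    rintro hk
    rcases hz.2.of_gsub with ⟨y, -, hy⟩ | ⟨c, hc⟩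
    · have := upd s x hφ.1 hs y hy
      simp only [Term.var.injEq] at hk
      (dsimp only [Var] at *; omega)
    · cases hc
  | snot φ ih | box φ ih | dia φ ih => exact ih hφ hs
  | imp φ ψ ih₁ ih₂ | and φ ψ ih₁ ih₂ | or φ ψ ih₁ ih₂ =>
    simp only [varBound, max_le_iff] at hφ
    exact ⟨ih₁ hφ.1 hs, ih₂ hφ.2 hs⟩

/-- New variables are at least `N`, hence neither equal to `x` nor bound in `φ`: no new free
occurrence of `x` arises, and a constant turned into a variable is not captured. -/
theorem Formula.FreeFor.gsub {f : C → Term ⟨P, ar, C'⟩} {φ : Formula ⟨P, ar, C⟩} {x : Var}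
    {t : Term ⟨P, ar, C⟩} {N : ℕ} (hφ : φ.varBound ≤ N) (hx : x < N)
    (hf : ∀ c y, f c = .var y → N ≤ y) (h : FreeFor x t φ) :
    FreeFor x (t.gsub f .var) (gsub f .var φ) := by
  induction φ with
  | bot | atom p r => trivial
  | all y φ ih | ex y φ ih =>
    simp only [varBound, max_le_iff] at hφ
    simp only [Formula.gsub, Function.update_eq_self]
    rintro ⟨hxy, hfree⟩
    have hfree' : FreeIn x φ := by
      rcases hfree.of_gsub with ⟨z, hz, e⟩ | ⟨c, hc⟩
      · cases e; exact hz
      · have := hf c x hc; (dsimp only [Var] at *; omega)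
    obtain ⟨h₁, h₂⟩ := h ⟨hxy, hfree'⟩
    refine ⟨?_, ih hφ.2 h₂⟩
    cases t with
    | var z => simpa [Term.gsub] using h₁
    | const c =>
      intro hc
      have := hf c y hc
      (dsimp only [Var] at *; omega)
  | snot φ ih | box φ ih | dia φ ih => exact ih hφ h
  | imp φ ψ ih₁ ih₂ | and φ ψ ih₁ ih₂ | or φ ψ ih₁ ih₂ =>
    simp only [varBound, max_le_iff] at hφ
    exact ⟨ih₁ hφ.1 h.1, ih₂ hφ.2 h.2⟩

theorem gsub_inst {f : C → Term ⟨P, ar, C'⟩} {φ : Formula ⟨P, ar, C⟩} {x : Var}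
    {t : Term ⟨P, ar, C⟩} {N : ℕ} (hφ : φ.varBound ≤ N) (hx : x < N)
    (hf : ∀ c y, f c = .var y → N ≤ y) :
    gsub f .var (inst x t φ) = inst x (t.gsub f .var) (gsub f .var φ) := by
  rw [inst, inst, subst_eq_gsub, subst_eq_gsub, gsub_var_gsub, gsub_gsub hφ hf (by simp_all)]
  congr 1
  · funext c
    cases hc : f c with
    | const d => simp [Term.gsub, hc]
    | var y =>
      have := hf c y hc
      simp [Term.gsub, hc, Function.update_of_ne (show y ≠ x by dsimp only [Var] at *; omega)]
  · funext y
    by_cases hyx : y = x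
    · subst hyx; simp [Term.gsub]
    · simp [Term.gsub, Function.update_of_ne hyx]

theorem gsub_inst_const (f : C → Term ⟨P, ar, C'⟩) (s : Var → Term ⟨P, ar, C'⟩)
    (hf : ∀ c y, f c ≠ .var y) (hs : ∀ x y, s x ≠ .var y) (x : Var) (c : C')
    (φ : Formula ⟨P, ar, C⟩) :
    inst x (.const c) (gsub f (Function.update s x (.var x)) φ) =
      gsub f (Function.update s x (.const c)) φ := by
  rw [inst, subst_eq_gsub, gsub_gsub le_rfl (fun c y h => (hf c y h).elim)]
  · congr 1
    · funext d
      cases hd : f d with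
      | const e => rfl
      | var y => exact (hf d y hd).elim
    · funext y
      by_cases hyx : y = x
      · subst hyx; simp [Term.gsub]
      · cases hy : s y with
        | const e => simp [Term.gsub, Function.update_of_ne hyx, hy]
        | var z => exact (hs y z hy).elim
  · intro y z h
    by_cases hyx : y = x
    · subst hyx
      simp only [Function.update_self, Term.var.injEq] at h
      exact .inl h.symm
    · rw [Function.update_of_ne hyx] at h
      exact (hs y z h).elim

/-! ## Replacing constants by fresh variables in derivations -/

/-- Only the two instantiation schemes need the freshness bound; the other schemes keep their shape
under any replacement of constants, even one with capture. -/
theorem BaseAx.gsub {φ : Formula ⟨P, ar, C⟩} (h : BaseAx φ) {f : C → Term ⟨P, ar, C'⟩} {N : ℕ}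
    (hφ : φ.varBound ≤ N) (hf : ∀ c y, f c = .var y → N ≤ y) : BaseAx (gsub f .var φ) := by
  cases h with
  | q1 x t φ h =>
    simp only [varBound, max_le_iff] at hφ
    simp only [Formula.gsub, Function.update_eq_self]
    rw [gsub_inst hφ.1.2 hφ.1.1 hf]
    exact .q1 _ _ _ (h.gsub hφ.1.2 hφ.1.1 hf)
  | q2 x t φ h =>
    simp only [varBound, max_le_iff] at hφ
    simp only [Formula.gsub, Function.update_eq_self]
    rw [gsub_inst hφ.2.2 hφ.2.1 hf]
    exact .q2 _ _ _ (h.gsub hφ.2.2 hφ.2.1 hf)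
  | _ =>
    simp only [Formula.gsub, Formula.iff, siff, neg, Function.update_eq_self]
    first
    | exact .i1 _ _ | exact .i2 _ _ _ | exact .c1 _ _ | exact .c2 _ _ | exact .c3 _ _
    | exact .d1 _ _ | exact .d2 _ _ | exact .d3 _ _ _ | exact .n1 _ | exact .n2 _
    | exact .sn1 _ | exact .sn2 _ _ | exact .sn3 _ _ | exact .sn4 _ _ | exact .sn5
    | exact .k1 _ _ | exact .k2 _ | exact .m1 _ | exact .m2 _ | exact .m3 _ | exact .m4 _
    | exact .q3 _ _ | exact .q4 _ _

theorem not_freeIn_gsub {f : C → Term ⟨P, ar, C'⟩} {φ : Formula ⟨P, ar, C⟩} {x : Var}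
    (hf : ∀ c, f c ≠ .var x) (h : ¬ FreeIn x φ) : ¬ FreeIn x (gsub f .var φ) := by
  intro hx
  rcases hx.of_gsub with ⟨z, hz, e⟩ | ⟨c, hc⟩
  · cases e; exact h hz
  · exact hf c hc

/-- The bound depends on the derivation: it must exceed the variables of its instantiation axioms
and the variables quantified by its Bernays steps. Only the existence of some bound matters later.
-/
theorem Sharp.exists_gsub {φ : Formula ⟨P, ar, C⟩} (h : Sharp φ) (C' : Type u) :
    ∃ N, ∀ f : C → Term ⟨P, ar, C'⟩, (∀ c y, f c = .var y → N ≤ y) → Sharp (gsub f .var φ) := by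
  induction h with
  | @base φ h => exact ⟨φ.varBound, fun f hf => .base (h.gsub le_rfl hf)⟩
  | ba x φ =>
    refine ⟨0, fun f hf => ?_⟩
    simp only [Formula.gsub, Function.update_eq_self]
    exact .ba _ _
  | mp _ _ ih₁ ih₂ =>
    obtain ⟨N₁, h₁⟩ := ih₁
    obtain ⟨N₂, h₂⟩ := ih₂
    exact ⟨max N₁ N₂, fun f hf =>
      .mp (h₁ f fun c y h => (max_le_iff.1 (hf c y h)).1)
        (h₂ f fun c y h => (max_le_iff.1 (hf c y h)).2)⟩
  | mb _ ih =>
    obtain ⟨N, h⟩ := ih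
    exact ⟨N, fun f hf => .mb (h f hf)⟩
  | md _ ih =>
    obtain ⟨N, h⟩ := ih
    exact ⟨N, fun f hf => .md (h f hf)⟩
  | @br1 x φ ψ hx _ ih =>
    obtain ⟨N, h⟩ := ih
    refine ⟨max N (x + 1), fun f hf => ?_⟩
    simp only [max_le_iff] at hf
    simp only [Formula.gsub, Function.update_eq_self]
    exact .br1 (not_freeIn_gsub (fun c hc => absurd (hf c x hc).2 (by dsimp only [Var] at *; omega))
      hx)
      (h f fun c y h => (hf c y h).1)
  | @br2 x φ ψ hx _ ih =>
    obtain ⟨N, h⟩ := ih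
    refine ⟨max N (x + 1), fun f hf => ?_⟩
    simp only [max_le_iff] at hf
    simp only [Formula.gsub, Function.update_eq_self]
    exact .br2 (not_freeIn_gsub (fun c hc => absurd (hf c x hc).2 (by dsimp only [Var] at *; omega))
      hx)
      (h f fun c y h => (hf c y h).1)

theorem Prov.exists_gsub {T : Set (Formula ⟨P, ar, C⟩)} {φ : Formula ⟨P, ar, C⟩} (h : Prov T φ)
    (C' : Type u) :
    ∃ N, ∀ f : C → Term ⟨P, ar, C'⟩, (∀ c y, f c = .var y → N ≤ y) →
      Prov (gsub f .var '' T) (gsub f .var φ) := by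
  induction h with
  | hyp h => exact ⟨0, fun f _ => .hyp ⟨_, h, rfl⟩⟩
  | logic h =>
    obtain ⟨N, h⟩ := h.exists_gsub C'
    exact ⟨N, fun f hf => .logic (h f hf)⟩
  | mp _ _ ih₁ ih₂ =>
    obtain ⟨N₁, h₁⟩ := ih₁
    obtain ⟨N₂, h₂⟩ := ih₂
    exact ⟨max N₁ N₂, fun f hf =>
      .mp (h₁ f fun c y h => (max_le_iff.1 (hf c y h)).1)
        (h₂ f fun c y h => (max_le_iff.1 (hf c y h)).2)⟩

/-- Fresh variables can be renamed back. -/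
theorem Derivable.of_shift {Γ : Set (Formula ⟨P, ar, C⟩)} {φ : Formula ⟨P, ar, C⟩} {N : ℕ}
    (hN : φ.varBound ≤ N) (h : Derivable Γ (gsub Term.const (fun x => .var (N + x)) φ)) :
    Derivable Γ φ := by
  -- Variables are restored one at a time, since a derivation permits only generalization followed
  -- by a single instantiation. At stage `k` the variable `N + k` stands for `k` alone, so it can be
  -- replaced without capture.
  have key : ∀ k, Derivable Γ
      (gsub Term.const (fun x => if x < k then .var x else .var (N + x)) φ) := by
    intro k
    induction k with
    | zero => simpa using h
    | succ k ih =>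
      have := ih.inst (x := N + k) (t := .var k)
        (freeFor_gsub (by dsimp only [Var] at *; omega) fun x hx => by
          split_ifs at hx <;> simp at hx <;> (dsimp only [Var] at *; omega))
      rw [QBK.Formula.inst, subst_eq_gsub, gsub_gsub hN (by simp) fun x y hx => by
        split_ifs at hx <;> simp at hx <;> (dsimp only [Var] at *; omega)] at this
      convert this using 2
      · rfl
      · funext x
        split_ifs with h₁ h₂ h₂
        · simp [Term.gsub, Function.update_of_ne (show x ≠ N + k by dsimp only [Var] at *; omega)]
        · obtain rfl : x = k := by dsimp only [Var] at *; omega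
          simp [Term.gsub]
        · (dsimp only [Var] at *; omega)
        · simp [Term.gsub,
            Function.update_of_ne (show N + x ≠ N + k by dsimp only [Var] at *; omega)]
  have := key φ.varBound
  rwa [gsub_congr (g := Term.const) (t := Term.var) (fun _ _ => rfl)
    fun x hx => if_pos hx.lt_varBound, gsub_const_var] at this

end Gsub

section Henkin

variable {σ : Signature.{u}} {T w : Set (Formula σ)}

/-! ## Countability of the language -/

instance [Countable σ.Const] : Countable (Term σ) := by
  have h : Function.Surjective (fun a : Var ⊕ σ.Const => a.elim Term.var Term.const) := fun t => by
    cases t with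
    | var x => exact ⟨.inl x, rfl⟩
    | const c => exact ⟨.inr c, rfl⟩
  exact h.countable

/-- The formulas of nesting depth less than `n`. -/
def layer (σ : Signature.{u}) : ℕ → Set (Formula σ)
  | 0 => ∅
  | n + 1 => {bot} ∪ (Set.range fun p : Σ P : σ.Pred, Fin (σ.arity P) → Term σ => atom p.1 p.2) ∪
      Set.image2 imp (layer σ n) (layer σ n) ∪ Set.image2 and (layer σ n) (layer σ n) ∪
      Set.image2 or (layer σ n) (layer σ n) ∪ snot '' layer σ n ∪ box '' layer σ n ∪
      dia '' layer σ n ∪ Set.image2 all Set.univ (layer σ n) ∪ Set.image2 ex Set.univ (layer σ n)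

theorem layer_mono : Monotone (layer σ) := by
  refine monotone_nat_of_le_succ fun n => ?_
  induction n with
  | zero => exact Set.empty_subset _
  | succ n ih =>
    rw [layer, layer]
    gcongr

theorem exists_mem_layer (φ : Formula σ) : ∃ n, φ ∈ layer σ n := by
  induction φ with
  | bot => exact ⟨1, by simp [layer]⟩
  | atom p t => exact ⟨1, by simp only [layer, Set.mem_union, Set.mem_range]; simp⟩
  | imp φ ψ ih₁ ih₂ | and φ ψ ih₁ ih₂ | or φ ψ ih₁ ih₂ =>
    obtain ⟨n, hn⟩ := ih₁
    obtain ⟨m, hm⟩ := ih₂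
    have h₁ := layer_mono (le_max_left n m) hn
    have h₂ := layer_mono (le_max_right n m) hm
    exact ⟨max n m + 1, by simp [layer, h₁, h₂]⟩
  | snot φ ih | box φ ih | dia φ ih | all x φ ih | ex x φ ih =>
    obtain ⟨n, hn⟩ := ih
    exact ⟨n + 1, by simp [layer, hn]⟩

theorem countable_layer [Countable σ.Pred] [Countable σ.Const] (n : ℕ) :
    (layer σ n).Countable := by
  induction n with
  | zero => exact Set.countable_empty
  | succ n ih =>
    simp only [layer, Set.countable_union]
    refine ⟨⟨⟨⟨⟨⟨⟨⟨⟨Set.countable_singleton _, Set.countable_range _⟩, ?_⟩, ?_⟩, ?_⟩, ?_⟩, ?_⟩,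
      ?_⟩, ?_⟩, ?_⟩
    all_goals first
    | exact ih.image _
    | exact ih.image2 ih _
    | exact Set.countable_univ.image2 ih _

/-- Countability serves to enumerate the witness requirements, and later to make the canonical model
small enough for any universe. -/
instance [Countable σ.Pred] [Countable σ.Const] : Countable (Formula σ) := by
  rw [← Set.countable_univ_iff]
  refine (Set.countable_iUnion fun n => countable_layer (σ := σ) n).mono fun φ _ => ?_
  exact Set.mem_iUnion.2 (exists_mem_layer φ)

/-! ## Omega-completeness and Henkin sets -/

theorem inst_of_not_freeIn {x : Var} {t : Term σ} {φ : Formula σ} (h : ¬ FreeIn x φ) :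
    inst x t φ = φ := by
  obtain ⟨P, ar, C⟩ := σ
  rw [inst, subst_eq_gsub]
  refine (gsub_congr (g := Term.const) (t := Term.var) (fun _ _ => rfl) fun y hy => ?_).trans
    (gsub_const_var φ)
  exact Function.update_of_ne (by rintro rfl; exact h hy) _ _

theorem isSentence_inst_const {x : Var} {c : σ.Const} {φ : Formula σ}
    (h : IsSentence (all x φ)) : IsSentence (inst x (.const c) φ) := by
  obtain ⟨P, ar, C⟩ := σ
  intro z hz
  rw [inst, subst_eq_gsub] at hz
  rcases hz.of_gsub with ⟨y, hy, e⟩ | ⟨c, hc⟩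
  · by_cases hyx : y = x
    · subst hyx; simp at e
    · exact h y ⟨hyx, hy⟩
  · cases hc

theorem Formula.IsSentence.neg {φ : Formula σ} (h : IsSentence φ) : IsSentence (neg φ) :=
  fun y hy => hy.elim (h y) id

/-- `T` derives a universal sentence as soon as it derives all its instances. -/
def OmegaComplete (T : Set (Formula σ)) : Prop :=
  ∀ x φ, IsSentence (all x φ) → (∀ c, Prov T (inst x (.const c) φ)) → Prov T (all x φ)

/-- The deduction theorem moves the sentence into an implication, and ∀ passes over its closed
antecedent. -/
theorem OmegaComplete.insert_sentence (hT : OmegaComplete T) {θ : Formula σ} (hθ : IsSentence θ) :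
    OmegaComplete (insert θ T) := by
  intro x φ hφ h
  have h₁ : Prov T (all x (imp θ φ)) := by
    refine hT x _ (fun y hy => hy.2.elim (hθ y) fun h => hφ y ⟨hy.1, h⟩) fun c => ?_
    have e : inst x (.const c) (imp θ φ) = imp θ (inst x (.const c) φ) :=
      congrArg (fun χ => imp χ _) (inst_of_not_freeIn (hθ x))
    rw [e]
    exact (h c).ded
  exact .mp (.hyp (Set.mem_insert _ _))
    (.mp (h₁.mono (Set.subset_insert _ _)) (.logic (sharp_all_imp_dist (hθ x))))

/-- Maximal consistent sets that contain a universal sentence as soon as they contain all its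
instances. -/
structure IsHenkin (T : Set (Formula σ)) : Prop extends IsMax T where
  henkin : ∀ x φ, IsSentence (all x φ) → (∀ c, inst x (.const c) φ ∈ T) → all x φ ∈ T

/-- If the requirement were inconsistent with `T` for every constant, `T` would derive every
instance and every negated requirement. By ω-completeness it would derive the universal sentence,
hence each requirement: a contradiction. No fresh constant is needed. -/
theorem OmegaComplete.exists_witness [Nonempty σ.Const] (hT : OmegaComplete T)
    (hcon : ¬ Prov T bot) (x : Var) (φ : Formula σ) : ∃ S, T ⊆ S ∧ (OmegaComplete S ∧ ¬ Prov S bot) ∧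
      (IsSentence (all x φ) → ∃ c, imp (inst x (.const c) φ) (all x φ) ∈ S) := by
  by_cases hφ : IsSentence (all x φ)
  · by_cases h : ∃ c, ¬ Prov (insert (imp (inst x (.const c) φ) (all x φ)) T) bot
    · obtain ⟨c, hc⟩ := h
      refine ⟨_, Set.subset_insert _ _, ⟨hT.insert_sentence fun y hy => ?_, hc⟩, fun _ => ⟨c, by simp⟩⟩
      exact hy.elim (isSentence_inst_const hφ y) (hφ y)
    · push Not at h
      have h' : ∀ c, Prov T (neg (imp (inst x (.const c) φ) (all x φ))) := fun c => (h c).ded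
      have h₁ : Prov T (all x φ) := hT x φ hφ fun c => prov_iff.2 fun u hu hTu => by
        have := prov_iff.1 (h' c) u hu hTu
        rw [hu.neg_mem, hu.imp_mem] at this
        tauto
      obtain ⟨c⟩ := ‹Nonempty σ.Const›
      exact (hcon (.mp (.weaken h₁) (h' c))).elim
  · exact ⟨T, subset_rfl, ⟨hT, hcon⟩, fun h => (hφ h).elim⟩

/-- All witness requirements are met in countably many ω-complete stages. The union need not be
shown ω-complete: the implications it contains give the Henkin property to any maximal extension. -/
theorem OmegaComplete.exists_isHenkin [Countable σ.Pred] [Countable σ.Const] [Nonempty σ.Const]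
    (hT : OmegaComplete T) (hcon : ¬ Prov T bot) : ∃ u, T ⊆ u ∧ IsHenkin u := by
  have : Nonempty (Formula σ) := ⟨bot⟩
  obtain ⟨e, he⟩ := exists_surjective_nat (Var × Formula σ)
  have step : ∀ (S : {S : Set (Formula σ) // OmegaComplete S ∧ ¬ Prov S bot})
      (p : Var × Formula σ), ∃ S' : {S : Set (Formula σ) // OmegaComplete S ∧ ¬ Prov S bot},
        S.1 ⊆ S'.1 ∧ (IsSentence (all p.1 p.2) →
          ∃ c, imp (inst p.1 (.const c) p.2) (all p.1 p.2) ∈ S'.1) := fun S p => by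
    obtain ⟨S', h, hS', hw⟩ := S.2.1.exists_witness S.2.2 p.1 p.2
    exact ⟨⟨S', hS'⟩, h, hw⟩
  choose next hnext hwit using step
  let seq : ℕ → {S : Set (Formula σ) // OmegaComplete S ∧ ¬ Prov S bot} :=
    fun n => Nat.rec ⟨T, hT, hcon⟩ (fun n S => next S (e n)) n
  have hmono : Monotone fun n => (seq n).1 := monotone_nat_of_le_succ fun n => hnext (seq n) (e n)
  have hU : ¬ Prov (⋃₀ Set.range fun n => (seq n).1) bot := fun h => by
    obtain ⟨_, ⟨n, rfl⟩, hn⟩ := Prov.exists_of_sUnion (Set.range_nonempty _)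
      (directedOn_range.2 hmono.directed_le) h
    exact (seq n).2.2 hn
  obtain ⟨u, hu, hmax⟩ := exists_isMax hU
  have hsub : ∀ n, (seq n).1 ⊆ u := fun n => (Set.subset_sUnion_of_mem (Set.mem_range_self n)).trans hu
  refine ⟨u, hsub 0, hmax, fun x φ hφ h => ?_⟩
  obtain ⟨n, hn⟩ := he (x, φ)
  have := hwit (seq n) (e n)
  rw [hn] at this
  obtain ⟨c, hc⟩ := this hφ
  have : imp (inst x (.const c) φ) (all x φ) ∈ u := by
    -- The requirement with index `n` enters in passing from stage `n` to stage `n + 1`.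
    refine hsub (n + 1) ?_
    change _ ∈ (next (seq n) (e n)).1
    rw [hn]; exact hc
  exact hmax.imp_mem.1 this (h c)

-- Quantifiers and modalities in Henkin sets

namespace IsHenkin

theorem all_mem (h : IsHenkin w) {x : Var} {φ : Formula σ} (hφ : IsSentence (all x φ)) :
    all x φ ∈ w ↔ ∀ c, inst x (.const c) φ ∈ w :=
  ⟨fun ha c => h.mem_of_sharp_imp (.base (.q1 x _ φ (freeFor_const x c φ))) ha, h.henkin x φ hφ⟩

theorem ex_mem (h : IsHenkin w) {x : Var} {φ : Formula σ} (hφ : IsSentence (ex x φ)) :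
    ex x φ ∈ w ↔ ∃ c, inst x (.const c) φ ∈ w := by
  refine ⟨fun he => ?_, fun ⟨c, hc⟩ =>
    h.mem_of_sharp_imp (.base (.q2 x _ φ (freeFor_const x c φ))) hc⟩
  by_contra! hc
  have h₁ : all x (neg φ) ∈ w := by
    refine h.henkin x _ (fun y hy => hφ y ⟨hy.1, hy.2.resolve_right id⟩) fun c => ?_
    exact h.neg_mem.2 (hc c)
  have h₂ : Sharp (imp (ex x φ) (neg (all x (neg φ)))) := by
    refine .br2 (by simp [FreeIn, neg]) (sharp_iff.2 fun u hu => ?_)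
    have := hu.mem_of_sharp (sharp_all_imp x (neg φ))
    simp only [hu.imp_mem, hu.neg_mem] at this ⊢
    tauto
  exact h.neg_mem.1 (h.mem_of_sharp_imp h₂ he) h₁

/-- If all instances follow from the boxed part, their necessitations lie in `w`; the Henkin
property gives ∀x□Φ and the Barcan formula gives □∀xΦ. -/
theorem omegaComplete_box (h : IsHenkin w) : OmegaComplete {ψ | box ψ ∈ w} := by
  intro x φ hφ hc
  refine .hyp (h.mem_of_sharp_imp (sharp_barcan_box x φ) (h.henkin x (box φ) hφ fun c => ?_))
  exact h.box_mem_of_prov (hc c)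

variable [Countable σ.Pred] [Countable σ.Const] [Nonempty σ.Const]

/-- If □Φ is missing, the boxed part together with ¬Φ is consistent and still ω-complete, so it
extends to a Henkin set over the same constants. -/
theorem box_mem (h : IsHenkin w) {φ : Formula σ} (hφ : IsSentence φ) :
    box φ ∈ w ↔ ∀ u, IsHenkin u → (∀ ψ, box ψ ∈ w → ψ ∈ u) → φ ∈ u := by
  refine ⟨fun hb u _ hR => hR φ hb, fun hb => ?_⟩
  by_contra hn
  have hcon : ¬ Prov (insert (neg φ) {ψ | box ψ ∈ w}) bot := fun hp => by
    refine hn (h.box_mem_of_prov (prov_iff.2 fun u hu hsub => ?_))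
    have h₁ : neg (neg φ) ∈ u := prov_iff.1 hp.ded u hu hsub
    rw [hu.neg_mem, hu.neg_mem] at h₁
    tauto
  obtain ⟨u, hu, hH⟩ := (h.omegaComplete_box.insert_sentence hφ.neg).exists_isHenkin hcon
  exact hH.neg_mem.1 (hu (Set.mem_insert _ _))
    (hb u hH fun ψ hψ => hu (Set.mem_insert_of_mem _ hψ))

theorem dia_mem (h : IsHenkin w) {φ : Formula σ} (hφ : IsSentence φ) :
    dia φ ∈ w ↔ ∃ u, IsHenkin u ∧ (∀ ψ, box ψ ∈ w → ψ ∈ u) ∧ φ ∈ u := by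
  have h₁ := h.mem_iff (.m2 φ)
  rw [h.neg_mem, h.box_mem hφ.neg] at h₁
  rw [← not_iff_not, h₁]
  push Not
  exact forall_congr' fun u => ⟨fun H hu hR => hu.neg_mem.1 (H hu hR),
    fun H hu hR => hu.neg_mem.2 (H hu hR)⟩

end IsHenkin

end Henkin

section Canonical

/-! ## The canonical model -/

variable {P : Type u} {ar : P → ℕ} {C C' : Type u} {D : Type w} {W : Type v}

/-- The canonical model; `κ` embeds the constants into the extended set of constants, which are
the elements of the common carrier. -/
abbrev canonicalModel [Nonempty W] [Nonempty D] (κ : C → C') (ε : D ≃ C')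
    (η : W ≃ {T : Set (Formula ⟨P, ar, C'⟩) // IsHenkin T}) : Model.{u, v, w} ⟨P, ar, C⟩ where
  World := W
  world_nonempty := inferInstance
  R i j := ∀ ψ, box ψ ∈ (η i).1 → ψ ∈ (η j).1
  U := D
  pos i :=
    { carrier := Set.univ
      carrier_nonempty := Set.univ_nonempty
      const c := ε.symm (κ c)
      const_mem _ := trivial
      rel p := {a | (atom p fun k => .const (ε (a k)) : Formula ⟨P, ar, C'⟩) ∈ (η i).1}
      rel_subset _ _ _ _ := trivial }
  neg i :=
    { carrier := Set.univ
      carrier_nonempty := Set.univ_nonempty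
      const c := ε.symm (κ c)
      const_mem _ := trivial
      rel p := {a | snot ((atom p fun k => .const (ε (a k)) : Formula ⟨P, ar, C'⟩)) ∈ (η i).1}
      rel_subset _ _ _ _ := trivial }
  carrier_eq _ := rfl
  const_eq _ _ := rfl
  carrier_mono _ _ _ := subset_rfl
  const_rigid _ _ _ _ := rfl

/-- Replace the variables by the constants that name their values. -/
def close (κ : C → C') (ε : D → C') (s : Var → D) :
    Formula ⟨P, ar, C⟩ → Formula ⟨P, ar, C'⟩ :=
  gsub (fun c => .const (κ c)) (fun x => .const (ε (s x)))

theorem isSentence_close (κ : C → C') (ε : D → C') (s : Var → D) (φ : Formula ⟨P, ar, C⟩) :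
    IsSentence (close κ ε s φ) := by
  intro z hz
  rcases hz.of_gsub with ⟨y, hy, e⟩ | ⟨c, hc⟩
  · cases e
  · cases hc

theorem inst_close (κ : C → C') (ε : D ≃ C') (s : Var → D) (φ : Formula ⟨P, ar, C⟩) (x : Var)
    (a : D) :
    inst x (.const (ε a)) (gsub (fun c => .const (κ c))
      (Function.update (fun x => .const (ε (s x))) x (.var x)) φ) =
    close κ ε (Function.update s x a) φ := by
  rw [gsub_inst_const _ _ (by simp) (by simp), close]
  congr 1
  funext y
  by_cases hyx : y = x
  · subst hyx; simp
  · simp [hyx]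

/-- Both equivalences go through one induction, since ∼ exchanges them and falsifying an implication
involves verifying its antecedent. -/
theorem canonicalModel_truth [Countable P] [Countable C'] [Nonempty C'] [Nonempty W] [Nonempty D]
    (κ : C → C') (ε : D ≃ C') (η : W ≃ {T : Set (Formula ⟨P, ar, C'⟩) // IsHenkin T})
    (φ : Formula ⟨P, ar, C⟩) (i : (canonicalModel κ ε η).World)
    (s : Var → (canonicalModel κ ε η).U) :
    ((canonicalModel κ ε η).Verifies φ i s ↔ close κ ε s φ ∈ (η i).1) ∧
    ((canonicalModel κ ε η).Falsifies φ i s ↔ snot (close κ ε s φ) ∈ (η i).1) := by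
  have : Countable (Signature.Pred ⟨P, ar, C'⟩) := ‹Countable P›
  have : Countable (Signature.Const ⟨P, ar, C'⟩) := ‹Countable C'›
  have : Nonempty (Signature.Const ⟨P, ar, C'⟩) := ‹Nonempty C'›
  have hw : ∀ i, IsHenkin (η i).1 := fun i => (η i).2
  have hall : ∀ (p : Set (Formula ⟨P, ar, C'⟩) → Prop),
      (∀ u, IsHenkin u → p u) ↔ ∀ j, p (η j).1 := fun p =>
    ⟨fun h j => h _ (hw j), fun h u hu => by simpa using h (η.symm ⟨u, hu⟩)⟩
  have hex : ∀ (p : Set (Formula ⟨P, ar, C'⟩) → Prop),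
      (∃ u, IsHenkin u ∧ p u) ↔ ∃ j, p (η j).1 := fun p =>
    ⟨fun ⟨u, hu, h⟩ => ⟨η.symm ⟨u, hu⟩, by simpa using h⟩, fun ⟨j, h⟩ => ⟨_, hw j, h⟩⟩
  have hval : ∀ (i : W) {n : ℕ} (r : Fin n → Term ⟨P, ar, C⟩) (s : Var → D),
      (fun k => (Term.const (ε ((r k).value ((canonicalModel κ ε η).pos i) s)) :
        Term ⟨P, ar, C'⟩)) =
      fun k => (r k).gsub (fun c => .const (κ c)) (fun x => .const (ε (s x))) := by
    intro i n r s
    funext k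
    cases r k with
    | var x => rfl
    | const c => exact congrArg _ (ε.apply_symm_apply _)
  induction φ generalizing i s with
  | bot =>
    simp only [Model.Verifies, Model.Falsifies, close, gsub, (hw i).bot_mem, true_iff, true_and]
    exact (hw i).mem_of_sharp (.base .sn5)
  | atom p r =>
    simp only [Model.Verifies, Model.Falsifies, close, gsub]
    have e := congrArg (fun a => (atom p a : Formula ⟨P, ar, C'⟩)) (hval i r s)
    exact ⟨iff_of_eq (congrArg (· ∈ (η i).1) e), iff_of_eq (congrArg (snot · ∈ (η i).1) e)⟩
  | imp φ ψ ih₁ ih₂ =>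
    simp only [Model.Verifies, Model.Falsifies]
    change (_ ↔ imp (close κ ε s φ) (close κ ε s ψ) ∈ _) ∧
      (_ ↔ snot (imp (close κ ε s φ) (close κ ε s ψ)) ∈ _)
    rw [(hw i).mem_iff (.sn2 _ _), (hw i).imp_mem, (hw i).and_mem, imp_iff_not_or]
    exact ⟨(not_congr (ih₁ i s).1).or (ih₂ i s).1, and_congr (ih₁ i s).1 (ih₂ i s).2⟩
  | and φ ψ ih₁ ih₂ =>
    simp only [Model.Verifies, Model.Falsifies]
    change (_ ↔ and (close κ ε s φ) (close κ ε s ψ) ∈ _) ∧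
      (_ ↔ snot (and (close κ ε s φ) (close κ ε s ψ)) ∈ _)
    rw [(hw i).mem_iff (.sn4 _ _), (hw i).or_mem, (hw i).and_mem]
    exact ⟨and_congr (ih₁ i s).1 (ih₂ i s).1, or_congr (ih₁ i s).2 (ih₂ i s).2⟩
  | or φ ψ ih₁ ih₂ =>
    simp only [Model.Verifies, Model.Falsifies]
    change (_ ↔ or (close κ ε s φ) (close κ ε s ψ) ∈ _) ∧
      (_ ↔ snot (or (close κ ε s φ) (close κ ε s ψ)) ∈ _)
    rw [(hw i).mem_iff (.sn3 _ _), (hw i).or_mem, (hw i).and_mem]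
    exact ⟨or_congr (ih₁ i s).1 (ih₂ i s).1, and_congr (ih₁ i s).2 (ih₂ i s).2⟩
  | snot φ ih =>
    simp only [Model.Verifies, Model.Falsifies]
    change (_ ↔ snot (close κ ε s φ) ∈ _) ∧ (_ ↔ snot (snot (close κ ε s φ)) ∈ _)
    rw [(hw i).mem_iff (.sn1 _)]
    exact ⟨(ih i s).2, (ih i s).1⟩
  | box φ ih =>
    simp only [Model.Verifies, Model.Falsifies]
    change (_ ↔ box (close κ ε s φ) ∈ _) ∧ (_ ↔ snot (box (close κ ε s φ)) ∈ _)
    have hs := isSentence_close κ ε s φ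
    -- The second half of ⇔ is the one required: ∼□Φ ↔ ∼∼◇∼Φ, which reduces to ◇∼Φ.
    have h₁ := (hw i).iff_mem.1 ((hw i).and_mem.1 ((hw i).mem_of_sharp (.base (.m3
      (close κ ε s φ))))).2
    rw [h₁, (hw i).mem_iff (.sn1 _), (hw i).box_mem hs, (hw i).dia_mem (φ := snot _) hs, hex, hall]
    exact ⟨forall_congr' fun j => imp_congr_right fun _ => (ih j s).1,
      exists_congr fun j => and_congr_right fun _ => (ih j s).2⟩
  | dia φ ih =>
    simp only [Model.Verifies, Model.Falsifies]
    change (_ ↔ dia (close κ ε s φ) ∈ _) ∧ (_ ↔ snot (dia (close κ ε s φ)) ∈ _)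
    have hs := isSentence_close κ ε s φ
    have h₁ := (hw i).iff_mem.1 ((hw i).and_mem.1 ((hw i).mem_of_sharp (.base (.m4
      (close κ ε s φ))))).2
    rw [h₁, (hw i).mem_iff (.sn1 _), (hw i).dia_mem hs, (hw i).box_mem (φ := snot _) hs, hex, hall]
    exact ⟨exists_congr fun j => and_congr_right fun _ => (ih j s).1,
      forall_congr' fun j => imp_congr_right fun _ => (ih j s).2⟩
  | all x φ ih =>
    simp only [Model.Verifies, Model.Falsifies]
    have hpos : ∀ (a : D) {p : Prop},
        (p ↔ close κ ε (Function.update s x a) φ ∈ (η i).1) →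
        (p ↔ inst x (.const (ε a)) (gsub (fun c => .const (κ c))
          (Function.update (fun x => .const (ε (s x))) x (.var x)) φ) ∈ (η i).1) :=
      fun a p h => by rwa [inst_close]
    have hneg : ∀ (a : D) {p : Prop},
        (p ↔ snot (close κ ε (Function.update s x a) φ) ∈ (η i).1) →
        (p ↔ inst x (.const (ε a)) (snot (gsub (fun c => .const (κ c))
          (Function.update (fun x => .const (ε (s x))) x (.var x)) φ)) ∈ (η i).1) :=
      fun a p h => by
        rw [← inst_close] at h
        exact h
    have hs := isSentence_close κ ε s (all x φ)
    simp only [close, gsub] at hs ⊢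
    rw [(hw i).all_mem hs, (hw i).mem_iff (.q3 _ _), (hw i).ex_mem (φ := snot _) hs,
      ← ε.forall_congr_right, ← ε.exists_congr_right]
    exact ⟨forall_congr' fun a => (imp_iff_right trivial).trans (hpos a (ih i _).1),
      exists_congr fun a => (and_iff_right trivial).trans (hneg a (ih i _).2)⟩
  | ex x φ ih =>
    simp only [Model.Verifies, Model.Falsifies]
    have hpos : ∀ (a : D) {p : Prop},
        (p ↔ close κ ε (Function.update s x a) φ ∈ (η i).1) →
        (p ↔ inst x (.const (ε a)) (gsub (fun c => .const (κ c))
          (Function.update (fun x => .const (ε (s x))) x (.var x)) φ) ∈ (η i).1) :=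
      fun a p h => by rwa [inst_close]
    have hneg : ∀ (a : D) {p : Prop},
        (p ↔ snot (close κ ε (Function.update s x a) φ) ∈ (η i).1) →
        (p ↔ inst x (.const (ε a)) (snot (gsub (fun c => .const (κ c))
          (Function.update (fun x => .const (ε (s x))) x (.var x)) φ)) ∈ (η i).1) :=
      fun a p h => by
        rw [← inst_close] at h
        exact h
    have hs := isSentence_close κ ε s (ex x φ)
    simp only [close, gsub] at hs ⊢
    rw [(hw i).ex_mem hs, (hw i).mem_iff (.q4 _ _), (hw i).all_mem (φ := snot _) hs,
      ← ε.forall_congr_right, ← ε.exists_congr_right]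
    exact ⟨exists_congr fun a => (and_iff_right trivial).trans (hpos a (ih i _).1),
      forall_congr' fun a => (imp_iff_right trivial).trans (hneg a (ih i _).2)⟩

end Canonical

section Initial

/-! ## The initial theory -/

variable {P : Type u} {ar : P → ℕ} {C : Type u}

/-- Read each variable `x` as a new constant, leaving infinitely many new constants unused. -/
def name : Formula ⟨P, ar, C⟩ → Formula ⟨P, ar, C ⊕ (ℕ ⊕ ℕ)⟩ :=
  close Sum.inl (fun x => .inr (.inl x)) id

theorem omegaComplete_name (G : Set (Formula ⟨P, ar, C⟩)) : OmegaComplete (name '' G) := by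
  intro x φ hφ h
  obtain ⟨n, hn⟩ : ∃ n : ℕ, (.inr (.inr n) : C ⊕ (ℕ ⊕ ℕ)) ∉ φ.consts := by
    by_contra! hc
    exact Set.infinite_of_injective_forall_mem
      (fun a b h => by simpa using h) hc (finite_consts φ)
  obtain ⟨N, hN⟩ := (h (.inr (.inr n))).exists_gsub (C ⊕ (ℕ ⊕ ℕ))
  -- `M` replaces the spare constant: `N` keeps the derivation valid, and the other two bounds make
  -- `M` new for `φ` and different from `x`.
  obtain ⟨M, hNM, hφM, hxM⟩ : ∃ M, N ≤ M ∧ φ.varBound ≤ M ∧ x < M :=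
    ⟨max N (max φ.varBound (x + 1)), by simp, by simp, by simp⟩
  classical
  let f : C ⊕ (ℕ ⊕ ℕ) → Term ⟨P, ar, C ⊕ (ℕ ⊕ ℕ)⟩ :=
    Function.update (fun c => .const c) (.inr (.inr n)) (.var M)
  have hf : ∀ c y, f c = .var y → M ≤ y := by
    intro c y hc
    by_cases e : c = .inr (.inr n)
    · subst e; simp [f] at hc; exact hc.le
    · exfalso; simp [f, Function.update_of_ne e] at hc
  have h₁ := hN f fun c y hc => hNM.trans (hf c y hc)
  rw [gsub_inst hφM hxM hf, gsub_congr (g := Term.const) (t := Term.var)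
    (fun c hc => Function.update_of_ne (by rintro rfl; exact hn hc) _ _) (fun _ _ => rfl),
    gsub_const_var] at h₁
  -- Named formulas contain no spare constant, so the replacement leaves the theory unchanged.
  have himg : gsub f .var '' (name '' G) = name '' G := by
    rw [Set.image_image]
    refine Set.image_congr fun ψ _ => ?_
    rw [name, close, gsub_var_gsub]
    rfl
  have hfM : Term.gsub f .var (.const (.inr (.inr n))) = .var M := by simp [Term.gsub, f]
  rw [himg, hfM] at h₁
  have h₂ : Prov (name '' G) (all M (inst x (.var M) φ)) := by
    refine h₁.gen ?_
    rintro _ ⟨ψ, -, rfl⟩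
    exact isSentence_close _ _ _ ψ _
  have hM : ¬ FreeIn M φ := fun h => h.lt_varBound.not_ge hφM
  have hback : inst M (.var x) (inst x (.var M) φ) = φ := by
    rw [inst, inst, subst_eq_gsub, subst_eq_gsub, gsub_gsub hφM (by simp)]
    · refine (gsub_congr (fun _ _ => rfl) fun y hy => ?_).trans (gsub_const_var φ)
      by_cases hyx : y = x
      · subst hyx; simp [Term.gsub]
      · simp [Term.gsub, hyx, Function.update_of_ne (show y ≠ M by rintro rfl; exact hM hy)]
    · intro y z hz
      by_cases hyx : y = x
      · subst hyx; simp at hz; exact .inr hz.le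
      · simp [hyx] at hz; exact .inl hz.symm
  have hfree : FreeFor M (.var x) (inst x (.var M) φ) := by
    -- `freeFor_gsub` demands that only `x` be sent to `M`. As `M` is not free in `φ`, the
    -- substitution may be changed to swap `M` and `x`.
    rw [inst, subst_eq_gsub, gsub_congr (g := Term.const)
      (t := Function.update (Function.update Term.var M (.var x)) x (.var M)) (fun _ _ => rfl)]
    · refine freeFor_gsub hφM fun y hy => ?_
      by_contra hyx
      rw [Function.update_of_ne hyx] at hy
      by_cases hyM : y = M
      · subst hyM
        simp only [Function.update_self, Term.var.injEq] at hy
        exact hxM.ne hy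
      · rw [Function.update_of_ne hyM, Term.var.injEq] at hy
        exact hyM hy
    · intro y hy
      have hyM : y ≠ M := by rintro rfl; exact hM hy
      by_cases hyx : y = x
      · subst hyx; simp
      · simp [hyx, hyM]
  have h₃ : Sharp (imp (all M (inst x (.var M) φ)) (all x φ)) := by
    refine .br1 (fun ⟨h, h'⟩ => ?_) ?_
    · rw [inst, subst_eq_gsub] at h'
      rcases h'.of_gsub with ⟨y, hy, e⟩ | ⟨c, hc⟩
      · by_cases hyx : y = x
        · subst hyx
          simp only [Function.update_self, Term.var.injEq] at e
          exact h e.symm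
        · exact hφ y ⟨hyx, hy⟩
      · cases hc
    · have := Sharp.base (.q1 M (.var x) _ hfree)
      rwa [hback] at this
  exact .mp h₂ (.logic h₃)

/-- If the named theory is inconsistent, then a disjunction is derivable. -/
theorem sharpProves_of_name {Γ Δ : Set (Formula ⟨P, ar, C⟩)} (hΓ : ∀ φ ∈ Γ, φ.IsSentence)
    (h : Prov (name '' (Γ ∪ neg '' Δ)) bot) : SharpProves Γ Δ := by
  have himg : (name '' (Γ ∪ neg '' Δ) : Set (Formula ⟨P, ar, C ⊕ (ℕ ⊕ ℕ)⟩)) =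
      name '' Γ ∪ neg '' (name '' Δ) := by
    rw [Set.image_union, Set.image_image, Set.image_image]
    rfl
  rw [himg] at h
  obtain ⟨l', hl', h⟩ := h.exists_listOr
  obtain ⟨l, hl, rfl⟩ : ∃ l : List (Formula ⟨P, ar, C⟩), (∀ φ ∈ l, φ ∈ Δ) ∧ l.map name = l' := by
    clear h
    induction l' with
    | nil => exact ⟨[], by simp⟩
    | cons a l' ih =>
      obtain ⟨l, hl, rfl⟩ := ih fun δ hδ => hl' δ (List.mem_cons_of_mem _ hδ)
      obtain ⟨b, hb, rfl⟩ := hl' a List.mem_cons_self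
      exact ⟨b :: l, by simpa using ⟨hb, hl⟩, rfl⟩
  have hor : ∀ l : List (Formula ⟨P, ar, C⟩), listOr (l.map name) = name (listOr l) := by
    intro l
    induction l with
    | nil => rfl
    | cons a l ih =>
      cases l with
      | nil => rfl
      | cons b l => exact congrArg (or (name a)) ih
  rw [hor] at h
  have h₁ : Prov (name '' Γ) (name (listOr l)) := prov_iff.2 fun u hu hT => by
    have := prov_iff.1 h u hu hT
    rw [hu.or_mem, hu.bot_mem] at this
    exact this.resolve_left id
  obtain ⟨N, hN⟩ := h₁.exists_gsub C
  obtain ⟨M, hNM, hlM⟩ : ∃ M, N ≤ M ∧ (listOr l).varBound ≤ M :=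
    ⟨max N (listOr l).varBound, by simp, by simp⟩
  let f : C ⊕ (ℕ ⊕ ℕ) → Term ⟨P, ar, C⟩ :=
    -- Spare constants may occur in the derivation but not in the named formulas. Any variable from
    -- `M` on serves for them, and the coincidence with the image of variable 0 is harmless.
    Sum.elim (fun c => .const c) (Sum.elim (fun x => .var (M + x)) fun _ => .var M)
  have hf : ∀ c y, f c = .var y → N ≤ y := by
    rintro (c | x | x) y hc <;> simp [f] at hc <;> (dsimp only [Var] at *; omega)
  have h₂ := hN f hf
  have hname : ∀ φ : Formula ⟨P, ar, C⟩,
      gsub f .var (name φ) = gsub Term.const (fun x => .var (M + x)) φ := by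
    intro φ
    rw [name, close, gsub_var_gsub]
    rfl
  have hΓ' : gsub f .var '' (name '' Γ) = Γ := by
    rw [Set.image_image]
    refine (Set.image_congr fun φ hφ => ?_).trans (Set.image_id Γ)
    rw [hname]
    exact (gsub_congr (fun _ _ => rfl) fun x hx => (hΓ φ hφ x hx).elim).trans (gsub_const_var φ)
  rw [hΓ', hname] at h₂
  exact ⟨_, ⟨l, hl, rfl⟩, h₂.derivable.of_shift hlM⟩

/-- Without a derivation, the named theory of Γ and the negations of Δ lies in a Henkin set. At that
world, with each variable denoting its own name, all of Γ and no member of Δ is verified. -/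
theorem sharpProves_of_sharpEntails [Countable P] [Countable C] {Γ Δ : Set (Formula ⟨P, ar, C⟩)}
    (hΓ : ∀ φ ∈ Γ, φ.IsSentence) (h : SharpEntails.{u, v, w} Γ Δ) : SharpProves Γ Δ := by
  by_contra hn
  have : Countable (Signature.Pred ⟨P, ar, C ⊕ (ℕ ⊕ ℕ)⟩) := ‹Countable P›
  have : Countable (Signature.Const ⟨P, ar, C ⊕ (ℕ ⊕ ℕ)⟩) :=
    inferInstanceAs (Countable (C ⊕ (ℕ ⊕ ℕ)))
  have : Nonempty (Signature.Const ⟨P, ar, C ⊕ (ℕ ⊕ ℕ)⟩) := ⟨.inr (.inl 0)⟩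
  obtain ⟨u, hu, hH⟩ := (omegaComplete_name (Γ ∪ neg '' Δ)).exists_isHenkin
    fun hp => hn (sharpProves_of_name hΓ hp)
  -- The language is countable, so constants and sets of formulas have copies in the prescribed
  -- universes.
  let η := (equivShrink.{v} {T : Set (Formula ⟨P, ar, C ⊕ (ℕ ⊕ ℕ)⟩) // IsHenkin T}).symm
  let ε := (equivShrink.{w} (C ⊕ (ℕ ⊕ ℕ))).symm
  have : Nonempty (C ⊕ (ℕ ⊕ ℕ)) := ⟨.inr (.inl 0)⟩
  have := ε.nonempty
  have : Nonempty {T : Set (Formula ⟨P, ar, C ⊕ (ℕ ⊕ ℕ)⟩) // IsHenkin T} := ⟨⟨u, hH⟩⟩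
  have := η.nonempty
  let s : Var → Shrink.{w} (C ⊕ (ℕ ⊕ ℕ)) := fun x => ε.symm (.inr (.inl x))
  have hs : ∀ φ : Formula ⟨P, ar, C⟩, close Sum.inl ε s φ = name φ := by
    intro φ
    simp [name, close, s]
  have truth := fun φ => (canonicalModel_truth Sum.inl ε η φ (η.symm ⟨u, hH⟩) s).1
  simp only [Equiv.apply_symm_apply, hs] at truth
  obtain ⟨ψ, hψ, hv⟩ := h (canonicalModel Sum.inl ε η) (fun _ _ => rfl) (η.symm ⟨u, hH⟩) s
    (fun _ => trivial) fun φ hφ => (truth φ).2 (hu ⟨φ, .inl hφ, rfl⟩)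
  exact hH.neg_mem.1 (hu ⟨neg ψ, .inr ⟨ψ, hψ, rfl⟩, rfl⟩) ((truth ψ).1 hv)

end Initial

section Soundness

/-! ## Soundness -/

variable {σ : Signature.{u}} {M : Model.{u, v, w} σ}

theorem Model.verifies_congr {φ : Formula σ} {i : M.World} {s t : Var → M.U}
    (h : ∀ x, FreeIn x φ → s x = t x) :
    (M.Verifies φ i s ↔ M.Verifies φ i t) ∧ (M.Falsifies φ i s ↔ M.Falsifies φ i t) := by
  induction φ generalizing i s t with
  | bot => simp [Verifies, Falsifies]
  | atom p r =>
    have hv : ∀ A : Struct σ M.U, (fun k => (r k).value A s) = fun k => (r k).value A t := by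
      intro A
      funext k
      cases hk : r k with
      | var x => exact h x ⟨k, hk⟩
      | const c => rfl
    simp [Verifies, Falsifies, hv]
  | imp φ ψ ih₁ ih₂ | and φ ψ ih₁ ih₂ | or φ ψ ih₁ ih₂ =>
    simp [Verifies, Falsifies, ih₁ fun x hx => h x (.inl hx), ih₂ fun x hx => h x (.inr hx)]
  | snot φ ih | box φ ih | dia φ ih => simp [Verifies, Falsifies, ih h]
  | all y φ ih | ex y φ ih =>
    have ih' := fun a => ih (i := i) (s := Function.update s y a)
      (t := Function.update t y a) fun x hx => by
        by_cases hxy : x = y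
        · subst hxy; simp
        · simpa [hxy] using h x ⟨hxy, hx⟩
    simp [Verifies, Falsifies, ih']

theorem inst_quantified {x y : Var} {t : Term σ} {φ : Formula σ} (hxy : x ≠ y) :
    subst (Function.update (Function.update Term.var x t) y (.var y)) φ = inst x t φ := by
  rw [inst, Function.update_comm hxy, Function.update_eq_self]

theorem Model.verifies_inst {φ : Formula σ} {x : Var} {t : Term σ} (hf : FreeFor x t φ)
    (i : M.World) (s : Var → M.U) :
    (M.Verifies (inst x t φ) i s ↔
      M.Verifies φ i (Function.update s x (t.value (M.pos i) s))) ∧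
    (M.Falsifies (inst x t φ) i s ↔
      M.Falsifies φ i (Function.update s x (t.value (M.pos i) s))) := by
  -- Since `t` is not the bound variable `y`, reassigning `y` does not change its value.
  have hquant : ∀ y : Var, t ≠ .var y → x ≠ y → ∀ (i : M.World) (s : Var → M.U) (a : M.U),
      Function.update (Function.update s y a) x (t.value (M.pos i) (Function.update s y a)) =
        Function.update (Function.update s x (t.value (M.pos i) s)) y a := by
    intro y ht hxy i s a
    rw [Function.update_comm hxy]
    refine congrArg (Function.update (Function.update s y a) x) ?_
    cases t with
    | var z =>
      have : z ≠ y := by rintro rfl; exact ht rfl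
      simp [Term.value, this]
    | const c => rfl
  -- Rigidity of constants along `R` keeps the value of `t` when a modality moves to another world.
  have hR : ∀ i j, M.R i j → ∀ s : Var → M.U, t.value (M.pos j) s = t.value (M.pos i) s := by
    intro i j hij s
    cases t with
    | var z => rfl
    | const c => exact (M.const_rigid i j hij c).symm
  induction φ generalizing i s with
  | bot => simp [inst, subst, Verifies, Falsifies]
  | atom p r =>
    have h₁ : (fun k => ((r k).subst (Function.update Term.var x t)).value (M.pos i) s) =
        fun k => (r k).value (M.pos i) (Function.update s x (t.value (M.pos i) s)) := by
      funext k
      cases r k with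
      | var y =>
        by_cases hyx : y = x
        · subst hyx; simp [Term.subst, Term.value]
        · simp [Term.subst, Term.value, hyx]
      | const c => rfl
    have h₂ : ∀ (r : Term σ) (s : Var → M.U), r.value (M.neg i) s = r.value (M.pos i) s := by
      intro r s
      cases r with
      | var y => rfl
      | const c => exact M.const_eq i c
    simp [inst, subst, Verifies, Falsifies, h₁, h₂]
  | imp φ ψ ih₁ ih₂ | and φ ψ ih₁ ih₂ | or φ ψ ih₁ ih₂ =>
    simp only [inst, subst, Verifies, Falsifies] at ih₁ ih₂ ⊢
    simp [ih₁ hf.1, ih₂ hf.2]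
  | snot φ ih =>
    simp only [inst, subst, Verifies, Falsifies] at ih ⊢
    simp [ih hf]
  | box φ ih =>
    simp only [inst, subst, Verifies, Falsifies] at ih ⊢
    exact ⟨forall_congr' fun j => imp_congr_right fun hij => by rw [(ih hf j s).1, hR i j hij],
      exists_congr fun j => and_congr_right fun hij => by rw [(ih hf j s).2, hR i j hij]⟩
  | dia φ ih =>
    simp only [inst, subst, Verifies, Falsifies] at ih ⊢
    exact ⟨exists_congr fun j => and_congr_right fun hij => by rw [(ih hf j s).1, hR i j hij],
      forall_congr' fun j => imp_congr_right fun hij => by rw [(ih hf j s).2, hR i j hij]⟩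
  | all y φ ih =>
    by_cases hfree : FreeIn x (all y φ)
    · obtain ⟨ht, hf⟩ := hf hfree
      simp only [inst, subst, inst_quantified hfree.1, Verifies, Falsifies]
      rw [← inst]
      simp only [ih hf, hquant y ht hfree.1, and_self]
    -- Here `FreeFor` gives no information, but neither the formula nor its value depends on `x`.
    · rw [inst_of_not_freeIn hfree]
      refine verifies_congr fun z hz => ?_
      rw [Function.update_of_ne (by rintro rfl; exact hfree hz)]
  | ex y φ ih =>
    by_cases hfree : FreeIn x (ex y φ)
    · obtain ⟨ht, hf⟩ := hf hfree
      simp only [inst, subst, inst_quantified hfree.1, Verifies, Falsifies]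
      rw [← inst]
      simp only [ih hf, hquant y ht hfree.1, and_self]
    · rw [inst_of_not_freeIn hfree]
      refine verifies_congr fun z hz => ?_
      rw [Function.update_of_ne (by rintro rfl; exact hfree hz)]

theorem Model.verifies_update {φ : Formula σ} {x : Var} (hx : ¬ FreeIn x φ) (i : M.World)
    (s : Var → M.U) (a : M.U) : M.Verifies φ i (Function.update s x a) ↔ M.Verifies φ i s :=
  by
  refine (verifies_congr fun y hy => ?_).1
  exact Function.update_of_ne (by rintro rfl; exact hx hy) _ _

theorem Term.value_mem {i : M.World} {s : Var → M.U} (hs : ∀ x, s x ∈ M.dom i) (t : Term σ) :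
    t.value (M.pos i) s ∈ M.dom i := by
  cases t with
  | var x => exact hs x
  | const c => exact (M.pos i).const_mem c

theorem update_mem {A : Set M.U} {s : Var → M.U} (hs : ∀ x, s x ∈ A) {a : M.U} (ha : a ∈ A)
    (x y : Var) : Function.update s x a y ∈ A := by
  by_cases h : y = x
  · subst h; simpa using ha
  · simpa [h] using hs y

theorem BaseAx.sound {φ : Formula σ} (h : BaseAx φ) (i : M.World) (s : Var → M.U)
    (hs : ∀ x, s x ∈ M.dom i) : M.Verifies φ i s := by
  cases h with
  | q1 x t φ h =>
    simp only [Model.Verifies, (Model.verifies_inst h i s).1]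
    exact imp_iff_not_or.1 fun h => h _ (t.value_mem hs)
  | q2 x t φ h =>
    simp only [Model.Verifies, (Model.verifies_inst h i s).1]
    exact imp_iff_not_or.1 fun h => ⟨_, t.value_mem hs, h⟩
  | k1 φ ψ => simp only [Model.Verifies]; grind
  | _ =>
    simp only [Formula.iff, siff, neg, Model.Verifies, Model.Falsifies] <;> first | tauto | grind

theorem Sharp.sound {φ : Formula σ} (h : Sharp φ) (hM : M.IsSharp) (i : M.World) (s : Var → M.U)
    (hs : ∀ x, s x ∈ M.dom i) : M.Verifies φ i s := by
  induction h generalizing i s with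
  | base h => exact h.sound i s hs
  | ba x φ =>
    simp only [Model.Verifies]
    refine imp_iff_not_or.1 ?_
    rintro ⟨j, hij, a, ha, h⟩
    exact ⟨a, hM i j ▸ ha, j, hij, h⟩
  | mp _ _ ih₁ ih₂ =>
    have := ih₂ i s hs
    rw [Model.Verifies] at this
    exact this.resolve_left (not_not.2 (ih₁ i s hs))
  | mb _ ih =>
    simp only [Model.Verifies] at ih ⊢
    refine imp_iff_not_or.1 fun h j hij => ?_
    exact (ih j s (hM i j ▸ hs)).resolve_left (not_not.2 (h j hij))
  | md _ ih =>
    simp only [Model.Verifies] at ih ⊢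
    refine imp_iff_not_or.1 fun ⟨j, hij, h⟩ => ⟨j, hij, ?_⟩
    exact (ih j s (hM i j ▸ hs)).resolve_left (not_not.2 h)
  | br1 hx _ ih =>
    simp only [Model.Verifies] at ih ⊢
    refine imp_iff_not_or.1 fun h a ha => ?_
    exact (ih i _ (update_mem hs ha _)).resolve_left
      (not_not.2 ((Model.verifies_update hx i s a).2 h))
  | br2 hx _ ih =>
    simp only [Model.Verifies] at ih ⊢
    refine imp_iff_not_or.1 fun ⟨a, ha, h⟩ => ?_
    exact (Model.verifies_update hx i s a).1
      ((ih i _ (update_mem hs ha _)).resolve_left (not_not.2 h))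

/-- Hypotheses must hold under all admissible assignments because the Bernays rules vary the
assignment. One fixed world is enough, as the modal rules apply only to theorems of `QBK♯`. -/
theorem Derivable.sound {Γ : Set (Formula σ)} {φ : Formula σ} (h : Derivable Γ φ)
    (hM : M.IsSharp) (i : M.World)
    (hΓ : ∀ ψ ∈ Γ, ∀ s : Var → M.U, (∀ x, s x ∈ M.dom i) → M.Verifies ψ i s) (s : Var → M.U)
    (hs : ∀ x, s x ∈ M.dom i) : M.Verifies φ i s := by
  induction h generalizing s with
  | hyp h => exact hΓ _ h s hs
  | logic h => exact h.sound hM i s hs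
  | mp _ _ ih₁ ih₂ =>
    have := ih₂ s hs
    rw [Model.Verifies] at this
    exact this.resolve_left (not_not.2 (ih₁ s hs))
  | br1 hx _ ih =>
    simp only [Model.Verifies] at ih ⊢
    refine imp_iff_not_or.1 fun h a ha => ?_
    exact (ih _ (update_mem hs ha _)).resolve_left
      (not_not.2 ((Model.verifies_update hx i s a).2 h))
  | br2 hx _ ih =>
    simp only [Model.Verifies] at ih ⊢
    refine imp_iff_not_or.1 fun ⟨a, ha, h⟩ => ?_
    exact (Model.verifies_update hx i s a).1
      ((ih _ (update_mem hs ha _)).resolve_left (not_not.2 h))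

theorem Model.verifies_listOr {l : List (Formula σ)} {i : M.World} {s : Var → M.U} :
    M.Verifies (listOr l) i s ↔ ∃ φ ∈ l, M.Verifies φ i s := by
  induction l with
  | nil => simp [listOr, Verifies]
  | cons a l ih =>
    cases l with
    | nil => simp [listOr]
    | cons b l => rw [listOr, Verifies, ih]; simp

theorem sharpEntails_of_sharpProves {Γ Δ : Set (Formula σ)} (hΓ : ∀ φ ∈ Γ, φ.IsSentence)
    (h : SharpProves Γ Δ) : SharpEntails.{u, v, w} Γ Δ := by
  obtain ⟨_, ⟨l, hl, rfl⟩, h⟩ := h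
  intro M hM i s hs hv
  -- Members of Γ are sentences, so verification under `s` carries over to every assignment.
  obtain ⟨φ, hφ, hφv⟩ := Model.verifies_listOr.1 (h.sound hM i (fun ψ hψ t _ =>
    (Model.verifies_congr fun x hx => (hΓ ψ hψ x hx).elim).1.1 (hv ψ hψ)) s hs)
  exact ⟨φ, hl φ hφ, hφv⟩

end Soundness

end QBK

theorem mainTheorem2 (σ : QBK.Signature.{u}) [Countable σ.Pred] [Countable σ.Const]
    (Γ Δ : Set (QBK.Formula σ)) (hΓ : ∀ φ ∈ Γ, φ.IsSentence) :
    QBK.SharpProves Γ Δ ↔ QBK.SharpEntails.{u, v, w} Γ Δ := by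
  obtain ⟨P, ar, C⟩ := σ
  have : Countable P := ‹_›
  have : Countable C := ‹_›
  exact ⟨QBK.sharpEntails_of_sharpProves hΓ, QBK.sharpProves_of_sharpEntails hΓ⟩
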